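/- There is a universal constant $K>0$ such that for every $\delta\in(0,1)$ there is $d_0=d_0(\delta)$ with the following property. Let $d_{in},d_{out}\ge 1$, put $d=\max\{d_{in},d_{out}\}$, and assume $d\ge d_0$ and $w\ge d$. Let $\sigma>0$ and let $C:\mathbb{R}^{d_{out}\times d_{in}}\to\mathbb{R}$ be any differentiable cost, with gradient $\nabla C(A)\in\mathbb{R}^{d_{out}\times d_{in}}$. Consider the shallow linear network $A_\theta=W_2W_1$ of width $w$, with $W_1\in\mathbb{R}^{w\times d_{in}}$ and $W_2\in\mathbb{R}^{d_{out}\times w}$, whose weights are initialized i.i.d. $\mathcal{N}(0,\sigma^2)$ and trained by gradient flow $\partial_t W_i=-\nabla_{W_i}\mathcal{L}$ on the loss $\mathcal{L}(W_1,W_2)=C(W_2W_1)$. Write $A=A_{\theta(t)}$, $C_1(t)=W_1^TW_1$, $C_2(t)=W_2W_2^T$, $\hat C_1(t)=\sqrt{A^TA+\sigma^4w^2I}$ and $\hat C_2(t)=\sqrt{AA^T+\sigma^4w^2I}$. Then with probability at least $1-\delta$ over the initialization, for all times $t\ge 0$ up to which the flow exists, \[ \|C_1(t)-\hat C_1(t)\|_{op},\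 \|C_2(t)-\hat C_2(t)\|_{op}\ \le\ M(t):=\min\Big\{K\sigma^2w,\ K\sqrt{\tfrac{d}{w}}\,\|C_1(t)\|_{op}\Big\}, \] and consequently $A_{\theta(t)}$ approximately follows the self-consistent mixed lazy/balanced dynamics, in the sense that \[ \partial_tA_{\theta(t)}=-\hat C_2(t)\nabla C(A_{\theta(t)})-\nabla C(A_{\theta(t)})\hat C_1(t)+E(t),\qquad \|E(t)\|_{op}\le 2M(t)\,\|\nabla C(A_{\theta(t)})\|_{op}. \] -/

import Mathlib

open MeasureTheory ProbabilityTheory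
open scoped Matrix MatrixOrder Matrix.Norms.L2Operator

/-- The law of an `m × n` array of i.i.d. `N(0, σ²)` random variables. -/
noncomputable def gaussianLaw (m n : ℕ) (σ : ℝ) : Measure (Fin m → Fin n → ℝ) :=
  Measure.pi fun _ => Measure.pi fun _ => gaussianReal 0 (σ ^ 2).toNNReal

/-- The law of the entries of the initial parameters `(W₁(0), W₂(0))` of a shallow linear network
with input dimension `din`, width `w` and output dimension `dout`: all weights are i.i.d.
`N(0, σ²)`. -/
noncomputable def initLaw (din w dout : ℕ) (σ : ℝ) :
    Measure ((Fin w → Fin din → ℝ) × (Fin dout → Fin w → ℝ)) :=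
  (gaussianLaw w din σ).prod (gaussianLaw dout w σ)

/-- The gradient of a real function of a matrix, viewed as a matrix: its `(i, j)` entry is the
partial derivative with respect to the `(i, j)` entry of the argument. -/
noncomputable def matrixGrad {m n : ℕ} (f : Matrix (Fin m) (Fin n) ℝ → ℝ)
    (X : Matrix (Fin m) (Fin n) ℝ) : Matrix (Fin m) (Fin n) ℝ :=
  Matrix.of fun i j => fderiv ℝ f X (Matrix.single i j 1)

/-- The training loss `L(W₁, W₂) = C(W₂ W₁)` of the linear network. -/
def netLoss {din w dout : ℕ} (C : Matrix (Fin dout) (Fin din) ℝ → ℝ)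
    (W₁ : Matrix (Fin w) (Fin din) ℝ) (W₂ : Matrix (Fin dout) (Fin w) ℝ) : ℝ :=
  C (W₂ * W₁)

/-- `(W₁, W₂)` solves on `[0, T]` the gradient flow of the loss `L(W₁, W₂) = C(W₂ W₁)`, that is
`∂ₜ W₁ = -∇_{W₁} L(W₁, W₂)` and `∂ₜ W₂ = -∇_{W₂} L(W₁, W₂)` (one-sided at the end points). -/
structure IsGradientFlow {din w dout : ℕ} (C : Matrix (Fin dout) (Fin din) ℝ → ℝ) (T : ℝ)
    (W₁ : ℝ → Matrix (Fin w) (Fin din) ℝ) (W₂ : ℝ → Matrix (Fin dout) (Fin w) ℝ) : Prop where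
  deriv_fst : ∀ t ∈ Set.Icc 0 T, HasDerivWithinAt W₁
    (-matrixGrad (fun V => netLoss C V (W₂ t)) (W₁ t)) (Set.Icc 0 T) t
  deriv_snd : ∀ t ∈ Set.Icc 0 T, HasDerivWithinAt W₂
    (-matrixGrad (fun V => netLoss C (W₁ t) V) (W₂ t)) (Set.Icc 0 T) t

/-- `Ĉ₁ = √(AᵀA + σ⁴ w² I)`, the positive semidefinite square root. -/
noncomputable def mixedC₁ {din dout : ℕ} (w : ℕ) (σ : ℝ) (A : Matrix (Fin dout) (Fin din) ℝ) :
    Matrix (Fin din) (Fin din) ℝ :=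
  CFC.sqrt (Aᵀ * A + (σ ^ 4 * (w : ℝ) ^ 2) • (1 : Matrix (Fin din) (Fin din) ℝ))

/-- `Ĉ₂ = √(AAᵀ + σ⁴ w² I)`, the positive semidefinite square root. -/
noncomputable def mixedC₂ {din dout : ℕ} (w : ℕ) (σ : ℝ) (A : Matrix (Fin dout) (Fin din) ℝ) :
    Matrix (Fin dout) (Fin dout) ℝ :=
  CFC.sqrt (A * Aᵀ + (σ ^ 4 * (w : ℝ) ^ 2) • (1 : Matrix (Fin dout) (Fin dout) ℝ))

/-- The error bound `min {K σ² w, K √(d / w) ‖C₁‖}` with `d = max din dout` and `C₁ = W₁ᵀ W₁`;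
the norm is the operator norm for the Euclidean norms. -/
noncomputable def mixedError {din : ℕ} (K : ℝ) (w dout : ℕ) (σ : ℝ)
    (W₁ : Matrix (Fin w) (Fin din) ℝ) : ℝ :=
  min (K * (σ ^ 2 * w)) (K * (√((max din dout : ℕ) / (w : ℝ)) * ‖W₁ᵀ * W₁‖))

/-! ### Quadratic forms, operator norms and square roots of real matrices. -/

section SpectralBounds

variable {m n : Type*} [Fintype m] [Fintype n]

/-! Write `s = σ² w`, `ε = √(d/w)`, `Z = (W₁ | W₂ᵀ)` and `J = diag(1, -1)`. Gradient flow conserves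
the imbalance `D = W₁W₁ᵀ - W₂ᵀW₂ = Z J Zᵀ`, and `C₁² - AᵀA = W₁ᵀ D W₁`, `C₂² - AAᵀ = -W₂ D W₂ᵀ`. So
`C₁² - Ĉ₁² = W₁ᵀ D W₁ - s²`, and likewise for the second layer: everything reduces to showing that
the diagonal blocks of `Zᵀ D Z` are close to those of `s² J`. The passage from squares to square
roots is `Matrix.norm_sub_le_of_abs_quadForm_le`.

At initialization `Z₀ᵀZ₀` is within `42 ε s` of `s` by Gaussian concentration on a net
(`measureReal_norm_stackedWeights_gram_sub_le`). Since `Z J Zᵀ = Z₀ J Z₀ᵀ` at later times, `Z = Z₀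
X` with `X` preserving `J`, and `Zᵀ D Z - s² J` is at most a multiple of `ε s ‖Z‖²`
(`norm_transpose_mul_imbalance_mul_sub_le`). This gives an error of order `ε ‖Z‖²`; the bound of
order `s` only needs `‖D‖ ≤ 43 s`.

To replace `‖Z‖²` by `‖C₁‖ = ‖W₁‖²`, and to treat `ε` of order one, `‖W₁‖²` must stay above a
multiple of `s`. As `D` is conserved, it is enough that `D` has a positive eigenvalue of order `s`
at time zero. When `w` is comparable to `d` this is not visible from the concentration of `Z₀ᵀZ₀`.
It comes from the independence of one column `v` of `W₁` and `W₂`: `v` is far from an eigenvector of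
`W₂ᵀW₂` (`measureReal_gram_correlation_le`), so a small move from `v` along `-W₂ᵀW₂v` makes the form
of `vvᵀ - W₂ᵀW₂` positive (`exists_large_quadForm`). -/

theorem Matrix.exists_mulVec_eq_smul_of_mem_spectrum [DecidableEq n] {M : Matrix n n ℝ} {l : ℝ}
    (hl : l ∈ spectrum ℝ M) : ∃ x : n → ℝ, x ≠ 0 ∧ M *ᵥ x = l • x := by
  rw [spectrum.mem_iff, Matrix.isUnit_iff_isUnit_det, isUnit_iff_ne_zero, not_not] at hl
  obtain ⟨x, hx, h⟩ := Matrix.exists_mulVec_eq_zero_iff.2 hl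
  refine ⟨x, hx, ?_⟩
  rw [Matrix.sub_mulVec, Algebra.algebraMap_eq_smul_one, Matrix.smul_mulVec,
    Matrix.one_mulVec, sub_eq_zero] at h
  exact h.symm

/-- A symmetric matrix has an eigenvalue of absolute value equal to its operator norm. -/
theorem Matrix.exists_mulVec_eq_smul_abs_eq_norm [DecidableEq n] [Nonempty n]
    {M : Matrix n n ℝ} (hM : Mᵀ = M) :
    ∃ (x : n → ℝ) (l : ℝ), x ≠ 0 ∧ M *ᵥ x = l • x ∧ |l| = ‖M‖ := by
  have hs : IsSelfAdjoint M := by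
    rw [IsSelfAdjoint, Matrix.star_eq_conjTranspose, Matrix.conjTranspose_eq_transpose_of_trivial,
      hM]
  obtain ⟨l, hl, h⟩ :=
    (IsometricContinuousFunctionalCalculus.isGreatest_norm_spectrum (𝕜 := ℝ) M hs).1
  obtain ⟨x, hx, hx'⟩ := Matrix.exists_mulVec_eq_smul_of_mem_spectrum hl
  exact ⟨x, l, hx, hx', h⟩

theorem dotProduct_self_pos_of_ne_zero {x : n → ℝ} (hx : x ≠ 0) : 0 < x ⬝ᵥ x := by
  refine lt_of_le_of_ne (Finset.sum_nonneg fun i _ => mul_self_nonneg _) fun h => hx ?_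
  exact dotProduct_self_eq_zero.1 h.symm

theorem dotProduct_self_nonneg' (x : n → ℝ) : 0 ≤ x ⬝ᵥ x := by
  simpa using dotProduct_star_self_nonneg x

theorem norm_toLp_sq_eq (x : n → ℝ) : ‖WithLp.toLp 2 x‖ ^ 2 = x ⬝ᵥ x := by
  rw [EuclideanSpace.real_norm_sq_eq]
  simp [dotProduct, pow_two]

theorem Matrix.dotProduct_mulVec_self_le [DecidableEq n] (A : Matrix m n ℝ)
    (x : n → ℝ) :
    (A *ᵥ x) ⬝ᵥ (A *ᵥ x) ≤ ‖A‖ ^ 2 * (x ⬝ᵥ x) := by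
  rw [← norm_toLp_sq_eq, ← norm_toLp_sq_eq, ← mul_pow]
  exact pow_le_pow_left₀ (norm_nonneg _) (Matrix.l2_opNorm_mulVec A (WithLp.toLp 2 x)) 2

theorem Matrix.abs_dotProduct_mulVec_le [DecidableEq n] (A : Matrix n n ℝ) (x : n → ℝ) :
    |x ⬝ᵥ A *ᵥ x| ≤ ‖A‖ * (x ⬝ᵥ x) := by
  have h : x ⬝ᵥ A *ᵥ x = inner ℝ (WithLp.toLp 2 x) (WithLp.toLp 2 (A *ᵥ x)) := by
    simp [PiLp.inner_apply, dotProduct, mul_comm]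
  rw [h, ← norm_toLp_sq_eq]
  refine (abs_real_inner_le_norm _ _).trans ?_
  have := Matrix.l2_opNorm_mulVec A (WithLp.toLp 2 x)
  calc _ ≤ ‖WithLp.toLp 2 x‖ * (‖A‖ * ‖WithLp.toLp 2 x‖) := by gcongr; exact this
    _ = _ := by ring

theorem Matrix.norm_transpose_mul_self [DecidableEq n] (A : Matrix m n ℝ) : ‖Aᵀ * A‖ = ‖A‖ ^ 2 := by
  rw [← Matrix.conjTranspose_eq_transpose_of_trivial, Matrix.l2_opNorm_conjTranspose_mul_self,
    pow_two]

theorem Matrix.norm_transpose_eq [DecidableEq m] [DecidableEq n] (A : Matrix m n ℝ) : ‖Aᵀ‖ = ‖A‖ := by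
  rw [← Matrix.conjTranspose_eq_transpose_of_trivial, Matrix.l2_opNorm_conjTranspose]

theorem Matrix.dotProduct_transpose_mul_self_mulVec (A : Matrix m n ℝ) (x : n → ℝ) :
    x ⬝ᵥ (Aᵀ * A) *ᵥ x = (A *ᵥ x) ⬝ᵥ (A *ᵥ x) := by
  rw [← Matrix.mulVec_mulVec, Matrix.dotProduct_mulVec, Matrix.vecMul_transpose]

theorem Matrix.dotProduct_transpose_mul_mul_mulVec (A : Matrix m n ℝ) (D : Matrix m m ℝ)
    (x : n → ℝ) : x ⬝ᵥ (Aᵀ * D * A) *ᵥ x = (A *ᵥ x) ⬝ᵥ D *ᵥ (A *ᵥ x) := by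
  rw [Matrix.mul_assoc, ← Matrix.mulVec_mulVec, Matrix.dotProduct_mulVec, Matrix.vecMul_transpose,
    Matrix.mulVec_mulVec]

theorem Matrix.norm_le_of_dotProduct_mulVec_self_le [DecidableEq n] {A : Matrix m n ℝ}
    {c : ℝ} (hc : 0 ≤ c)
    (h : ∀ x, (A *ᵥ x) ⬝ᵥ (A *ᵥ x) ≤ c ^ 2 * (x ⬝ᵥ x)) : ‖A‖ ≤ c := by
  rw [Matrix.l2_opNorm_def]
  refine ContinuousLinearMap.opNorm_le_bound _ hc fun x => ?_
  have := h x.ofLp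
  rw [← norm_toLp_sq_eq, ← norm_toLp_sq_eq, ← mul_pow] at this
  exact le_of_sq_le_sq this (by positivity)

/-- A Lyapunov-type perturbation bound for positive semidefinite square roots. -/
theorem Matrix.norm_sub_le_of_abs_quadForm_le [DecidableEq n] {a b : Matrix n n ℝ} {c : ℝ} (hc : 0 ≤ c)
    (ha : a.PosSemidef) (hb : b.PosSemidef) (hpos : ∀ x, x ≠ 0 → 0 < x ⬝ᵥ b *ᵥ x)
    (h : ∀ x, |x ⬝ᵥ (a * a - b * b) *ᵥ x| ≤ c * (x ⬝ᵥ a *ᵥ x + x ⬝ᵥ b *ᵥ x)) :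
    ‖a - b‖ ≤ c := by
  have hat : aᵀ = a := by simpa using ha.isHermitian.eq
  have hbt : bᵀ = b := by simpa using hb.isHermitian.eq
  rcases isEmpty_or_nonempty n with hn | hn
  · rw [Subsingleton.elim (a - b) 0, norm_zero]; exact hc
  obtain ⟨x, l, hx, hl, hn⟩ :=
    Matrix.exists_mulVec_eq_smul_abs_eq_norm (M := a - b) (by rw [Matrix.transpose_sub, hat, hbt])
  rw [← hn]
  -- At an eigenvector of `a - b`, the splitting `a² - b² = a(a - b) + (a - b)b` turns the form of
  -- `a² - b²` into the eigenvalue times the form of `a + b`, although `a` and `b` need not commute.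
  have h1 : x ⬝ᵥ (a * a - b * b) *ᵥ x = l * (x ⬝ᵥ a *ᵥ x + x ⬝ᵥ b *ᵥ x) := by
    have e : a * a - b * b = a * (a - b) + (a - b)ᵀ * b := by
      rw [Matrix.transpose_sub, hat, hbt]; noncomm_ring
    have e1 : x ⬝ᵥ ((a - b)ᵀ * b) *ᵥ x = l * (x ⬝ᵥ b *ᵥ x) := by
      rw [← Matrix.mulVec_mulVec, Matrix.dotProduct_mulVec, Matrix.vecMul_transpose, hl,
        smul_dotProduct, smul_eq_mul]
    rw [e, Matrix.add_mulVec, dotProduct_add, e1, ← Matrix.mulVec_mulVec, hl, Matrix.mulVec_smul,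
      dotProduct_smul, smul_eq_mul]
    ring
  have h2 : 0 < x ⬝ᵥ a *ᵥ x + x ⬝ᵥ b *ᵥ x :=
    add_pos_of_nonneg_of_pos (by simpa using ha.dotProduct_mulVec_nonneg x) (hpos x hx)
  have h3 := h x
  rw [h1, abs_mul, abs_of_pos h2] at h3
  exact le_of_mul_le_mul_right h3 h2

/-- The scalar case of operator monotonicity of the square root: every eigenvalue `l ≥ 0` of `b`
satisfies `s² ≤ l²`. -/
theorem Matrix.le_dotProduct_mulVec_of_sq [DecidableEq n] {b : Matrix n n ℝ} {s : ℝ}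
    (hb : b.PosSemidef) (h : ∀ x, s ^ 2 * (x ⬝ᵥ x) ≤ x ⬝ᵥ (b * b) *ᵥ x) (x : n → ℝ) :
    s * (x ⬝ᵥ x) ≤ x ⬝ᵥ b *ᵥ x := by
  have hbt : bᵀ = b := by simpa using hb.isHermitian.eq
  have key : algebraMap ℝ (Matrix n n ℝ) s ≤ b := by
    rw [algebraMap_le_iff_le_spectrum (R := ℝ) (p := IsSelfAdjoint) (ha := hb.isHermitian)]
    intro l hl
    obtain ⟨y, hy, hy'⟩ := Matrix.exists_mulVec_eq_smul_of_mem_spectrum hl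
    have hyy := dotProduct_self_pos_of_ne_zero hy
    have h1 := h y
    rw [← Matrix.mulVec_mulVec, hy', Matrix.mulVec_smul, hy', dotProduct_smul, dotProduct_smul,
      smul_eq_mul, smul_eq_mul, ← mul_assoc, ← pow_two] at h1
    have h2 := hb.dotProduct_mulVec_nonneg y
    simp only [star_trivial] at h2
    rw [hy', dotProduct_smul, smul_eq_mul] at h2
    have h3 : 0 ≤ l := nonneg_of_mul_nonneg_left h2 hyy
    exact le_of_sq_le_sq (le_of_mul_le_mul_right h1 hyy) h3
  have := (Matrix.le_iff.1 key).dotProduct_mulVec_nonneg x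
  simp only [star_trivial] at this
  rw [Algebra.algebraMap_eq_smul_one, Matrix.sub_mulVec, Matrix.smul_mulVec,
    Matrix.one_mulVec, dotProduct_sub, dotProduct_smul, smul_eq_mul] at this
  linarith

end SpectralBounds

/-! ### The mixed square roots and their comparison with a Gram matrix. -/

section MixedRoot

variable {din dout w : ℕ}

theorem posSemidef_gram_add_smul_one {m n : Type*} [Fintype m] [Fintype n] [DecidableEq n]
    (A : Matrix m n ℝ) {r : ℝ} (hr : 0 ≤ r) :
    (Aᵀ * A + r • (1 : Matrix n n ℝ)).PosSemidef := by
  refine Matrix.PosSemidef.add ?_ (Matrix.PosSemidef.one.smul hr)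
  simpa using Matrix.posSemidef_conjTranspose_mul_self A

theorem mixedC₁_posSemidef (σ : ℝ) (A : Matrix (Fin dout) (Fin din) ℝ) :
    (mixedC₁ w σ A).PosSemidef :=
  Matrix.nonneg_iff_posSemidef.1 (CFC.sqrt_nonneg _)

theorem mixedC₁_mul_self (σ : ℝ) (A : Matrix (Fin dout) (Fin din) ℝ) :
    mixedC₁ w σ A * mixedC₁ w σ A
      = Aᵀ * A + (σ ^ 4 * (w : ℝ) ^ 2) • (1 : Matrix (Fin din) (Fin din) ℝ) :=
  CFC.sqrt_mul_sqrt_self _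
    (Matrix.nonneg_iff_posSemidef.2 (posSemidef_gram_add_smul_one A (by positivity)))

/-- The ridge `σ⁴ w²` puts a floor `σ² w` under the root. It makes the root positive definite and
allows the error budget to be stated without the root itself. -/
theorem le_dotProduct_mixedC₁ (σ : ℝ) (A : Matrix (Fin dout) (Fin din) ℝ) (x : Fin din → ℝ) :
    (σ ^ 2 * w) * (x ⬝ᵥ x) ≤ x ⬝ᵥ mixedC₁ w σ A *ᵥ x := by
  refine Matrix.le_dotProduct_mulVec_of_sq (mixedC₁_posSemidef σ A) (fun y => ?_) x
  rw [mixedC₁_mul_self, Matrix.add_mulVec, dotProduct_add,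
    Matrix.dotProduct_transpose_mul_self_mulVec, Matrix.smul_mulVec, Matrix.one_mulVec,
    dotProduct_smul, smul_eq_mul]
  have := dotProduct_self_nonneg' (A *ᵥ y)
  nlinarith

/-- Transposing the network exchanges the layers, so estimates are needed for the first layer only.
-/
theorem mixedC₂_eq_mixedC₁_transpose (σ : ℝ) (A : Matrix (Fin dout) (Fin din) ℝ) :
    mixedC₂ w σ A = mixedC₁ w σ Aᵀ := by
  rw [mixedC₁, mixedC₂, Matrix.transpose_transpose]

/-- Comparison of `W₁ᵀ W₁` with the mixed square root when the quadratic form of the imbalance,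
restricted to the range of `W₁`, is controlled. -/
theorem norm_gram_sub_mixedC₁_le {σ c : ℝ} (hσ : 0 < σ) (hw : 0 < w) (hc : 0 ≤ c)
    (W₁ : Matrix (Fin w) (Fin din) ℝ) (W₂ : Matrix (Fin dout) (Fin w) ℝ)
    (h : ∀ x : Fin din → ℝ,
      |(W₁ *ᵥ x) ⬝ᵥ (W₁ * W₁ᵀ - W₂ᵀ * W₂) *ᵥ (W₁ *ᵥ x) - (σ ^ 2 * w) ^ 2 * (x ⬝ᵥ x)|
        ≤ c * ((W₁ *ᵥ x) ⬝ᵥ (W₁ *ᵥ x) + σ ^ 2 * w * (x ⬝ᵥ x))) :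
    ‖W₁ᵀ * W₁ - mixedC₁ w σ (W₂ * W₁)‖ ≤ c := by
  have hs : 0 < σ ^ 2 * (w : ℝ) := by positivity
  refine Matrix.norm_sub_le_of_abs_quadForm_le hc
    (by simpa using Matrix.posSemidef_conjTranspose_mul_self W₁) (mixedC₁_posSemidef _ _)
    (fun x hx => ?_) (fun x => ?_)
  · have := le_dotProduct_mixedC₁ (w := w) σ (W₂ * W₁) x
    have := mul_pos hs (dotProduct_self_pos_of_ne_zero hx)
    linarith
  -- The key identity: `C₁² - AᵀA = W₁ᵀ (W₁W₁ᵀ - W₂ᵀW₂) W₁`.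
  · have e : W₁ᵀ * W₁ * (W₁ᵀ * W₁) - mixedC₁ w σ (W₂ * W₁) * mixedC₁ w σ (W₂ * W₁)
        = W₁ᵀ * (W₁ * W₁ᵀ - W₂ᵀ * W₂) * W₁ - ((σ ^ 2 * (w : ℝ)) ^ 2) • 1 := by
      rw [mixedC₁_mul_self, Matrix.transpose_mul, Matrix.mul_sub, Matrix.sub_mul,
        show σ ^ 4 * (w : ℝ) ^ 2 = (σ ^ 2 * w) ^ 2 by ring]
      simp only [Matrix.mul_assoc]
      abel
    rw [e, Matrix.sub_mulVec, dotProduct_sub, Matrix.dotProduct_transpose_mul_mul_mulVec,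
      Matrix.dotProduct_transpose_mul_self_mulVec, Matrix.smul_mulVec, Matrix.one_mulVec,
      dotProduct_smul, smul_eq_mul]
    exact (h x).trans (by gcongr; exact le_dotProduct_mixedC₁ (w := w) σ (W₂ * W₁) x)

end MixedRoot

/-! ### Two factorizations of the same indefinite form. -/

section Imbalance

variable {p q : Type*} [Fintype p] [Fintype q] [DecidableEq p]

theorem Matrix.norm_le_one_of_transpose_mul_self_eq_one {J : Matrix q p ℝ} (hJ : Jᵀ * J = 1) :
    ‖J‖ ≤ 1 := by
  refine Matrix.norm_le_of_dotProduct_mulVec_self_le zero_le_one fun x => ?_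
  rw [← Matrix.dotProduct_transpose_mul_self_mulVec, hJ, Matrix.one_mulVec, one_pow, one_mul]

/-- A kernel vector of `M` would be scaled by exactly `s` under `s • 1 - M`, against the bound `s /
2`. -/
theorem Matrix.isUnit_of_norm_sub_smul_one_le {M : Matrix p p ℝ} {s θ : ℝ} (hs : 0 < s)
    (hθ : θ ≤ 1 / 2) (h : ‖M - s • 1‖ ≤ θ * s) : IsUnit M := by
  rw [Matrix.isUnit_iff_isUnit_det, isUnit_iff_ne_zero]
  intro h0
  obtain ⟨x, hx, hx0⟩ := Matrix.exists_mulVec_eq_zero_iff.2 h0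
  have h1 := Matrix.abs_dotProduct_mulVec_le (M - s • 1) x
  have hxx := dotProduct_self_pos_of_ne_zero hx
  rw [Matrix.sub_mulVec, hx0, Matrix.smul_mulVec, Matrix.one_mulVec, zero_sub, dotProduct_neg,
    dotProduct_smul, smul_eq_mul, abs_neg, abs_of_pos (by positivity)] at h1
  have h2 := le_of_mul_le_mul_right h1 hxx
  nlinarith

/-- If two factors `Z`, `Z₀` of the same indefinite form `Z J Zᵀ` are given and `Z₀` is nearly a
multiple of an isometry, then `Zᵀ (Z J Zᵀ) Z` is nearly a multiple of `J`. -/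
theorem norm_transpose_mul_imbalance_mul_sub_le [DecidableEq q] {J : Matrix p p ℝ} (hJt : Jᵀ = J)
    (hJ : J * J = 1) {Z Z₀ : Matrix q p ℝ} (hZ : Z * J * Zᵀ = Z₀ * J * Z₀ᵀ) {s θ : ℝ} (hs : 0 < s)
    (hθ0 : 0 ≤ θ) (hθ : θ ≤ 1 / 2) (h : ‖Z₀ᵀ * Z₀ - s • 1‖ ≤ θ * s) :
    ‖Zᵀ * (Z * J * Zᵀ) * Z - s ^ 2 • J‖ ≤ 6 * θ * s * ‖Z‖ ^ 2 := by
  set M := Z₀ᵀ * Z₀ with hM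
  have hMu : IsUnit M.det :=
    (Matrix.isUnit_iff_isUnit_det _).1 (Matrix.isUnit_of_norm_sub_smul_one_le hs hθ h)
  have hJn : ‖J‖ ≤ 1 := Matrix.norm_le_one_of_transpose_mul_self_eq_one (by rw [hJt, hJ])
  -- `X` is the least-squares solution of `Z = Z₀ X`, and `Y` is its inverse, read off from `Z J Zᵀ
  -- = Z₀ J Z₀ᵀ` by cancelling `Z₀ᵀ` and `J` on the right.
  obtain ⟨X, hX⟩ : ∃ X, X = M⁻¹ * Z₀ᵀ * Z := ⟨_, rfl⟩
  obtain ⟨Y, hY⟩ : ∃ Y, Y = J * Zᵀ * Z₀ * M⁻¹ * J := ⟨_, rfl⟩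
  clear_value M
  have hZY : Z * Y = Z₀ := by
    calc Z * Y = (Z * J * Zᵀ) * Z₀ * M⁻¹ * J := by simp only [hY, Matrix.mul_assoc]
      _ = Z₀ * J * (M * M⁻¹) * J := by rw [hZ, hM]; simp only [Matrix.mul_assoc]
      _ = Z₀ := by
        rw [Matrix.mul_nonsing_inv _ hMu, Matrix.mul_one, Matrix.mul_assoc, hJ, Matrix.mul_one]
  have hXY : X * Y = 1 := by
    calc X * Y = M⁻¹ * (Z₀ᵀ * (Z * Y)) := by simp only [hX, Matrix.mul_assoc]
      _ = 1 := by rw [hZY, ← hM, Matrix.nonsing_inv_mul _ hMu]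
  have hYX : Y * X = 1 := mul_eq_one_comm.1 hXY
  have hZX : Z = Z₀ * X := by rw [← hZY, Matrix.mul_assoc, hYX, Matrix.mul_one]
  have hXJ : X * J * Xᵀ = J := by
    have e : M * (X * J * Xᵀ) * M = M * J * M := by
      calc M * (X * J * Xᵀ) * M = Z₀ᵀ * ((Z₀ * X) * J * (Z₀ * X)ᵀ) * Z₀ := by
            rw [Matrix.transpose_mul]; simp only [hM, Matrix.mul_assoc]
        _ = M * J * M := by rw [← hZX, hZ]; simp only [hM, Matrix.mul_assoc]
    calc X * J * Xᵀ = (M⁻¹ * M) * (X * J * Xᵀ) * (M * M⁻¹) := by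
          rw [Matrix.mul_nonsing_inv _ hMu, Matrix.nonsing_inv_mul _ hMu]; simp
      _ = M⁻¹ * (M * (X * J * Xᵀ) * M) * M⁻¹ := by simp only [Matrix.mul_assoc]
      _ = (M⁻¹ * M) * J * (M * M⁻¹) := by rw [e]; simp only [Matrix.mul_assoc]
      _ = J := by rw [Matrix.mul_nonsing_inv _ hMu, Matrix.nonsing_inv_mul _ hMu]; simp
  -- `X J Xᵀ = J` says that `J Xᵀ J` is a right inverse of `X`; for square matrices it is then also
  -- a left inverse.
  have hXJ' : Xᵀ * J * X = J := by
    have e : X * (J * Xᵀ * J) = 1 := by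
      rw [← Matrix.mul_assoc, ← Matrix.mul_assoc, hXJ, hJ]
    have e' := mul_eq_one_comm.1 e
    calc Xᵀ * J * X = (J * J) * Xᵀ * J * X := by rw [hJ, Matrix.one_mul]
      _ = J * (J * Xᵀ * J * X) := by simp only [Matrix.mul_assoc]
      _ = J := by rw [e', Matrix.mul_one]
  set R := M - s • (1 : Matrix p p ℝ) with hR
  have hMR : M = s • 1 + R := by rw [hR]; abel
  -- From `ZᵀZ = Xᵀ M X` with `M = s + R`; the `R` term is absorbed on the left because `θ ≤ 1/2`.
  have hXn : s * ‖X‖ ^ 2 ≤ 2 * ‖Z‖ ^ 2 := by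
    have e : s • (Xᵀ * X) = Zᵀ * Z - Xᵀ * R * X := by
      rw [hZX, Matrix.transpose_mul, hR, hM]
      simp only [Matrix.mul_sub, Matrix.sub_mul, Matrix.mul_assoc]
      simp
    have e1 : s * ‖X‖ ^ 2 ≤ ‖Z‖ ^ 2 + ‖X‖ * (θ * s) * ‖X‖ := by
      calc s * ‖X‖ ^ 2 = ‖s • (Xᵀ * X)‖ := by
            rw [norm_smul, Matrix.norm_transpose_mul_self, Real.norm_of_nonneg hs.le]
        _ ≤ ‖Zᵀ * Z‖ + ‖Xᵀ * R * X‖ := by rw [e]; exact norm_sub_le _ _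
        _ ≤ _ := by
          rw [Matrix.norm_transpose_mul_self]
          gcongr
          refine (norm_mul_le _ _).trans ?_
          gcongr
          refine (norm_mul_le _ _).trans ?_
          rw [Matrix.norm_transpose_eq]
          gcongr
    have : θ * (s * ‖X‖ ^ 2) ≤ 1 / 2 * (s * ‖X‖ ^ 2) := by gcongr
    nlinarith
  -- Since `J = Xᵀ J X`, both terms are conjugates by `X`, and the difference is `Xᵀ (M J M - s² J)
  -- X`, which vanishes with `R`.
  have e : Zᵀ * (Z * J * Zᵀ) * Z - s ^ 2 • J
      = Xᵀ * (s • (R * J) + s • (J * R) + R * J * R) * X := by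
    calc Zᵀ * (Z * J * Zᵀ) * Z - s ^ 2 • J
        = Xᵀ * (M * J * M) * X - s ^ 2 • (Xᵀ * J * X) := by
          rw [hXJ', hZ, hZX, Matrix.transpose_mul]; simp only [hM, Matrix.mul_assoc]
      _ = _ := by
        rw [hMR]
        simp only [Matrix.mul_add, Matrix.add_mul, Matrix.smul_mul, Matrix.mul_smul,
          Matrix.one_mul, Matrix.mul_one, smul_smul, smul_add, Matrix.mul_assoc, pow_two]
        abel
  have hRJ : ‖s • (R * J) + s • (J * R) + R * J * R‖ ≤ 3 * θ * s ^ 2 := by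
    have h1 : ‖R * J‖ ≤ θ * s :=
      (norm_mul_le _ _).trans (by nlinarith [norm_nonneg R, norm_nonneg J])
    have h2 : ‖J * R‖ ≤ θ * s :=
      (norm_mul_le _ _).trans (by nlinarith [norm_nonneg R, norm_nonneg J])
    have h3 : ‖R * J * R‖ ≤ θ * s * (θ * s) := (norm_mul_le _ _).trans (by gcongr)
    have hθs : θ * s * (θ * s) ≤ θ * s ^ 2 := by nlinarith [mul_nonneg hθ0 (sq_nonneg s)]
    calc _ ≤ ‖s • (R * J)‖ + ‖s • (J * R)‖ + ‖R * J * R‖ := norm_add₃_le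
      _ ≤ s * (θ * s) + s * (θ * s) + θ * s * (θ * s) := by
        rw [norm_smul, norm_smul, Real.norm_of_nonneg hs.le]; gcongr
      _ ≤ _ := by nlinarith
  rw [e]
  calc _ ≤ ‖X‖ * (3 * θ * s ^ 2) * ‖X‖ := by
        refine (norm_mul_le _ _).trans ?_
        gcongr
        refine (norm_mul_le _ _).trans ?_
        rw [Matrix.norm_transpose_eq]
        gcongr
    _ = 3 * θ * s * (s * ‖X‖ ^ 2) := by ring
    _ ≤ 3 * θ * s * (2 * ‖Z‖ ^ 2) := by gcongr
    _ = _ := by ring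

end Imbalance

/-! ### Deterministic bounds for the two layers from the conserved imbalance. -/

section Balancedness

variable {din dout w : ℕ}

/-- The weights of both layers, viewed as a single matrix `(W₁ | W₂ᵀ)`. -/
def stackedWeights (W₁ : Matrix (Fin w) (Fin din) ℝ) (W₂ : Matrix (Fin dout) (Fin w) ℝ) :
    Matrix (Fin w) (Fin din ⊕ Fin dout) ℝ :=
  Matrix.fromCols W₁ W₂ᵀ

/-- The signature matrix `diag(1, -1)`. -/
def signatureMatrix (din dout : ℕ) : Matrix (Fin din ⊕ Fin dout) (Fin din ⊕ Fin dout) ℝ :=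
  Matrix.fromBlocks 1 0 0 (-1)

theorem signatureMatrix_transpose : (signatureMatrix din dout)ᵀ = signatureMatrix din dout := by
  simp [signatureMatrix, Matrix.fromBlocks_transpose]

theorem signatureMatrix_mul_self : signatureMatrix din dout * signatureMatrix din dout = 1 := by
  simp [signatureMatrix, Matrix.fromBlocks_multiply]

theorem stackedWeights_mul_signatureMatrix_mul (W₁ : Matrix (Fin w) (Fin din) ℝ)
    (W₂ : Matrix (Fin dout) (Fin w) ℝ) :
    stackedWeights W₁ W₂ * signatureMatrix din dout * (stackedWeights W₁ W₂)ᵀ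
      = W₁ * W₁ᵀ - W₂ᵀ * W₂ := by
  simp [stackedWeights, signatureMatrix, Matrix.fromCols_mul_fromBlocks,
    Matrix.transpose_fromCols, Matrix.fromCols_mul_fromRows, sub_eq_add_neg]

theorem norm_stackedWeights_sq_le (W₁ : Matrix (Fin w) (Fin din) ℝ)
    (W₂ : Matrix (Fin dout) (Fin w) ℝ) :
    ‖stackedWeights W₁ W₂‖ ^ 2 ≤ ‖W₁‖ ^ 2 + ‖W₂‖ ^ 2 := by
  rw [← Matrix.norm_transpose_eq, ← Matrix.norm_transpose_mul_self, Matrix.transpose_transpose]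
  have : stackedWeights W₁ W₂ * (stackedWeights W₁ W₂)ᵀ = W₁ᵀᵀ * W₁ᵀ + W₂ᵀ * W₂ := by
    simp [stackedWeights, Matrix.transpose_fromCols, Matrix.fromCols_mul_fromRows]
  rw [this]
  refine (norm_add_le _ _).trans_eq ?_
  rw [Matrix.norm_transpose_mul_self, Matrix.norm_transpose_mul_self, Matrix.norm_transpose_eq]

theorem norm_sq_le_of_norm_gram_sub_le {p q : Type*} [Fintype p] [Fintype q] [DecidableEq p]
    {Z : Matrix q p ℝ} {s b : ℝ} (hs : 0 ≤ s) (h : ‖Zᵀ * Z - s • 1‖ ≤ b) : ‖Z‖ ^ 2 ≤ s + b := by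
  rw [← Matrix.norm_transpose_mul_self]
  calc ‖Zᵀ * Z‖ = ‖s • (1 : Matrix p p ℝ) + (Zᵀ * Z - s • 1)‖ := by congr 1; abel
    _ ≤ ‖s • (1 : Matrix p p ℝ)‖ + ‖Zᵀ * Z - s • 1‖ := norm_add_le _ _
    _ ≤ s * 1 + b := by
      rw [norm_smul, Real.norm_of_nonneg hs]
      gcongr
      exact Matrix.norm_le_one_of_transpose_mul_self_eq_one (by simp)
    _ = s + b := by ring

/-- The layerwise Gram matrices are close to the mixed square roots as soon as the imbalance agrees
with that of weights which are nearly isometric and has a large positive eigenvalue. -/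
theorem norm_gram_sub_mixed_le {σ ε a c : ℝ} (hσ : 0 < σ) (hw : 0 < w) (hε0 : 0 ≤ ε) (hε : ε ≤ 1)
    (ha : 0 < a) (hc : 0 < c) {W₁ U₁ : Matrix (Fin w) (Fin din) ℝ}
    {W₂ U₂ : Matrix (Fin dout) (Fin w) ℝ}
    (hD : W₁ * W₁ᵀ - W₂ᵀ * W₂ = U₁ * U₁ᵀ - U₂ᵀ * U₂)
    (hG : ‖(stackedWeights U₁ U₂)ᵀ * stackedWeights U₁ U₂ - (σ ^ 2 * w) • 1‖
      ≤ a * ε * (σ ^ 2 * w))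
    (hu : ∃ u : Fin w → ℝ, u ≠ 0 ∧
      c * (σ ^ 2 * w) * (u ⬝ᵥ u) ≤ u ⬝ᵥ (U₁ * U₁ᵀ - U₂ᵀ * U₂) *ᵥ u) :
    let K := (1 + a) + 2 * (1 + a) * a / c + 6 * a * (2 + (1 + a) / c)
    let M := min (K * (σ ^ 2 * w)) (K * (ε * ‖W₁ᵀ * W₁‖))
    ‖W₁ᵀ * W₁ - mixedC₁ w σ (W₂ * W₁)‖ ≤ M ∧ ‖W₂ * W₂ᵀ - mixedC₂ w σ (W₂ * W₁)‖ ≤ M := by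
  intro K M
  set s : ℝ := σ ^ 2 * w with hsdef
  have hs : 0 < s := by positivity
  set D := W₁ * W₁ᵀ - W₂ᵀ * W₂ with hDdef
  set J := signatureMatrix din dout
  set Z := stackedWeights W₁ W₂ with hZdef
  have hJt : Jᵀ = J := signatureMatrix_transpose
  have hJJ : J * J = 1 := signatureMatrix_mul_self
  have hZD : Z * J * Zᵀ = D := stackedWeights_mul_signatureMatrix_mul W₁ W₂
  have hUD : stackedWeights U₁ U₂ * J * (stackedWeights U₁ U₂)ᵀ = D := by
    rw [hD]; exact stackedWeights_mul_signatureMatrix_mul U₁ U₂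
  have hDn : ‖D‖ ≤ (1 + a) * s := by
    have h1 := norm_sq_le_of_norm_gram_sub_le hs.le hG
    have hJn : ‖J‖ ≤ 1 := Matrix.norm_le_one_of_transpose_mul_self_eq_one (by rw [hJt, hJJ])
    calc ‖D‖ ≤ ‖stackedWeights U₁ U₂‖ * 1 * ‖stackedWeights U₁ U₂‖ := by
          rw [← hUD]
          refine (Matrix.l2_opNorm_mul _ _).trans ?_
          rw [Matrix.norm_transpose_eq]
          gcongr
          refine (Matrix.l2_opNorm_mul _ _).trans ?_
          gcongr
      _ = ‖stackedWeights U₁ U₂‖ ^ 2 := by ring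
      _ ≤ s + a * ε * s := h1
      _ ≤ s + a * 1 * s := by gcongr
      _ = _ := by ring
  have hDq : ∀ y : Fin w → ℝ, |y ⬝ᵥ D *ᵥ y| ≤ (1 + a) * s * (y ⬝ᵥ y) := fun y =>
    (Matrix.abs_dotProduct_mulVec_le D y).trans
      (mul_le_mul_of_nonneg_right hDn (dotProduct_self_nonneg' y))
  have hC1 : ‖W₁ᵀ * W₁‖ = ‖W₁‖ ^ 2 := Matrix.norm_transpose_mul_self W₁
  -- Only the `W₁W₁ᵀ` part of the imbalance contributes positively to its form, so the large
  -- positive direction of `U₁U₁ᵀ - U₂ᵀU₂` forces `W₁` to be large.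
  have hlow : c * s ≤ ‖W₁‖ ^ 2 := by
    obtain ⟨u, hu0, hu⟩ := hu
    have huu := dotProduct_self_pos_of_ne_zero hu0
    rw [← hD, hDdef, Matrix.sub_mulVec, dotProduct_sub,
      Matrix.dotProduct_transpose_mul_self_mulVec] at hu
    have h1 := Matrix.dotProduct_mulVec_self_le W₁ᵀ u
    rw [Matrix.norm_transpose_eq, ← Matrix.dotProduct_transpose_mul_self_mulVec,
      Matrix.transpose_transpose] at h1
    have h2 := dotProduct_self_nonneg' (W₂ *ᵥ u)
    exact le_of_mul_le_mul_right (by linarith) huu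
  have hW2 : ‖W₂‖ ^ 2 ≤ ‖W₁‖ ^ 2 + (1 + a) * s := by
    have e : W₂ᵀ * W₂ = W₁ᵀᵀ * W₁ᵀ - D := by rw [hDdef, Matrix.transpose_transpose]; abel
    rw [← Matrix.norm_transpose_mul_self W₂, e]
    refine (norm_sub_le _ _).trans ?_
    rw [Matrix.norm_transpose_mul_self, Matrix.norm_transpose_eq]
    gcongr
  have hZn : ‖Z‖ ^ 2 ≤ (2 + (1 + a) / c) * ‖W₁‖ ^ 2 := by
    have h1 := norm_stackedWeights_sq_le W₁ W₂
    have h2 : (1 + a) * s ≤ (1 + a) / c * ‖W₁‖ ^ 2 := by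
      rw [div_mul_eq_mul_div, le_div_iff₀ hc]; nlinarith
    linarith
  have key : ∀ b : ℝ, 0 ≤ b →
      (∀ x : Fin din → ℝ, |(W₁ *ᵥ x) ⬝ᵥ D *ᵥ (W₁ *ᵥ x) - s ^ 2 * (x ⬝ᵥ x)|
        ≤ b * ((W₁ *ᵥ x) ⬝ᵥ (W₁ *ᵥ x) + s * (x ⬝ᵥ x))) →
      (∀ x : Fin dout → ℝ, |(W₂ᵀ *ᵥ x) ⬝ᵥ D *ᵥ (W₂ᵀ *ᵥ x) + s ^ 2 * (x ⬝ᵥ x)|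
        ≤ b * ((W₂ᵀ *ᵥ x) ⬝ᵥ (W₂ᵀ *ᵥ x) + s * (x ⬝ᵥ x))) →
      ‖W₁ᵀ * W₁ - mixedC₁ w σ (W₂ * W₁)‖ ≤ b ∧ ‖W₂ * W₂ᵀ - mixedC₂ w σ (W₂ * W₁)‖ ≤ b := by
    intro b hb h1 h2
    refine ⟨norm_gram_sub_mixedC₁_le hσ hw hb W₁ W₂ h1, ?_⟩
    -- The second layer is the first layer of the transposed network, whose imbalance is `-D`; hence
    -- the plus sign in the second assumption.
    have := norm_gram_sub_mixedC₁_le (c := b) hσ hw hb W₂ᵀ W₁ᵀ fun x => by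
      have e : W₂ᵀ * W₂ᵀᵀ - W₁ᵀᵀ * W₁ᵀ = -D := by
        rw [hDdef, Matrix.transpose_transpose, Matrix.transpose_transpose, neg_sub]
      rw [e, Matrix.neg_mulVec, dotProduct_neg, ← neg_add', abs_neg]
      exact h2 x
    rwa [Matrix.transpose_transpose, ← Matrix.transpose_mul,
      ← mixedC₂_eq_mixedC₁_transpose] at this
  have hbase : ∀ t r : ℝ, 0 ≤ r → |t| ≤ (1 + a) * s * r → ∀ q : ℝ, 0 ≤ q →
      |t| + s ^ 2 * q ≤ (1 + a) * s * (r + s * q) := by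
    intro t r _ ht q hq
    have : 0 ≤ a * s ^ 2 * q := by positivity
    nlinarith
  -- The crude bound, with no cancellation between `D` and `s²`: each is compared separately with
  -- the right-hand side.
  have first := key ((1 + a) * s) (by positivity)
    (fun x => by
      have hx := dotProduct_self_nonneg' x
      refine (abs_sub _ _).trans ?_
      rw [abs_of_nonneg (by positivity : 0 ≤ s ^ 2 * (x ⬝ᵥ x))]
      exact hbase _ _ (dotProduct_self_nonneg' _) (hDq _) _ hx)
    (fun x => by
      have hx := dotProduct_self_nonneg' x
      refine (abs_add_le _ _).trans ?_
      rw [abs_of_nonneg (by positivity : 0 ≤ s ^ 2 * (x ⬝ᵥ x))]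
      exact hbase _ _ (dotProduct_self_nonneg' _) (hDq _) _ hx)
  have hK1 : (1 + a) ≤ K := by
    have : 0 ≤ 2 * (1 + a) * a / c + 6 * a * (2 + (1 + a) / c) := by positivity
    simp only [K]; linarith
  have hK2 : 2 * (1 + a) * a / c ≤ K := by
    have : 0 ≤ (1 + a) + 6 * a * (2 + (1 + a) / c) := by positivity
    simp only [K]; linarith
  have hK3 : 6 * a * (2 + (1 + a) / c) ≤ K := by
    have : 0 ≤ (1 + a) + 2 * (1 + a) * a / c := by positivity
    simp only [K]; linarith
  have hM1 : (1 + a) * s ≤ K * s := by gcongr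
  have second : ∃ b, b ≤ K * (ε * ‖W₁‖ ^ 2) ∧ ‖W₁ᵀ * W₁ - mixedC₁ w σ (W₂ * W₁)‖ ≤ b ∧
      ‖W₂ * W₂ᵀ - mixedC₂ w σ (W₂ * W₁)‖ ≤ b := by
    -- For small `a ε` the initial Gram matrix is invertible and the factorization argument applies.
    -- Otherwise `ε` is bounded below, and the crude bound `(1 + a) s` is already at most a multiple
    -- of `ε ‖W₁‖²`, since `c s ≤ ‖W₁‖²`.
    rcases le_or_gt (a * ε) (1 / 2) with hθ | hθ
    · refine ⟨6 * (a * ε) * ‖Z‖ ^ 2, ?_, ?_⟩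
      · calc 6 * (a * ε) * ‖Z‖ ^ 2 ≤ 6 * (a * ε) * ((2 + (1 + a) / c) * ‖W₁‖ ^ 2) := by gcongr
          _ = 6 * a * (2 + (1 + a) / c) * (ε * ‖W₁‖ ^ 2) := by ring
          _ ≤ _ := by gcongr
      · have hN := norm_transpose_mul_imbalance_mul_sub_le hJt hJJ (hZD.trans hUD.symm) hs
          (by positivity) hθ hG
        have hq : ∀ X : Fin din ⊕ Fin dout → ℝ,
            |(Z *ᵥ X) ⬝ᵥ D *ᵥ (Z *ᵥ X) - s ^ 2 * (X ⬝ᵥ J *ᵥ X)|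
              ≤ 6 * (a * ε) * ‖Z‖ ^ 2 * (s * (X ⬝ᵥ X)) := by
          intro X
          have h1 := (Matrix.abs_dotProduct_mulVec_le _ X).trans
            (mul_le_mul_of_nonneg_right hN (dotProduct_self_nonneg' X))
          rw [Matrix.sub_mulVec, dotProduct_sub, Matrix.dotProduct_transpose_mul_mul_mulVec, hZD,
            Matrix.smul_mulVec, dotProduct_smul, smul_eq_mul] at h1
          refine h1.trans_eq ?_
          ring
        -- Test vectors `(x, 0)` and `(0, x)` pick out the diagonal blocks, where `J` is `1` and
        -- `-1`.
        refine key _ (by positivity) (fun x => ?_) (fun x => ?_)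
        · have h1 := hq (Sum.elim x 0)
          have e1 : Z *ᵥ Sum.elim x 0 = W₁ *ᵥ x := by
            simp [hZdef, stackedWeights, Matrix.fromCols_mulVec]
          have e2 : Sum.elim x (0 : Fin dout → ℝ) ⬝ᵥ J *ᵥ Sum.elim x 0 = x ⬝ᵥ x := by
            simp [J, signatureMatrix, Matrix.fromBlocks_mulVec]
          have e3 : Sum.elim x (0 : Fin dout → ℝ) ⬝ᵥ Sum.elim x 0 = x ⬝ᵥ x := by simp
          rw [e1, e2, e3] at h1
          refine h1.trans ?_
          have := dotProduct_self_nonneg' (W₁ *ᵥ x)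
          gcongr
          linarith
        · have h1 := hq (Sum.elim 0 x)
          have e1 : Z *ᵥ Sum.elim 0 x = W₂ᵀ *ᵥ x := by
            simp [hZdef, stackedWeights, Matrix.fromCols_mulVec]
          have e2 : Sum.elim (0 : Fin din → ℝ) x ⬝ᵥ J *ᵥ Sum.elim 0 x = -(x ⬝ᵥ x) := by
            simp [J, signatureMatrix, Matrix.fromBlocks_mulVec, Matrix.neg_mulVec]
          have e3 : Sum.elim (0 : Fin din → ℝ) x ⬝ᵥ Sum.elim 0 x = x ⬝ᵥ x := by simp
          rw [e1, e2, e3, mul_neg, sub_neg_eq_add] at h1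
          refine h1.trans ?_
          have := dotProduct_self_nonneg' (W₂ᵀ *ᵥ x)
          gcongr
          linarith
    · refine ⟨(1 + a) * s, ?_, first⟩
      calc (1 + a) * s ≤ (1 + a) * s * (2 * (a * ε)) := by
            refine le_mul_of_one_le_right (by positivity) (by linarith)
        _ = 2 * (1 + a) * a / c * (ε * (c * s)) := by field_simp
        _ ≤ K * (ε * ‖W₁‖ ^ 2) := by gcongr
  obtain ⟨b, hb, hb1, hb2⟩ := second
  simp only [M, hC1]
  exact ⟨le_min (first.1.trans hM1) (hb1.trans hb), le_min (first.2.trans hM1) (hb2.trans hb)⟩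

end Balancedness

/-! ### Chain rule for the loss, conservation of the imbalance, and the dynamics of the product. -/

section GradientFlow

variable {l m n : ℕ}

/-- Matrix multiplication as a continuous bilinear map. -/
noncomputable def Matrix.mulCLM (l m n : ℕ) :
    Matrix (Fin l) (Fin m) ℝ →L[ℝ] Matrix (Fin m) (Fin n) ℝ →L[ℝ] Matrix (Fin l) (Fin n) ℝ :=
  LinearMap.mkContinuous₂
    (LinearMap.mk₂ ℝ (fun A B => A * B) Matrix.add_mul (fun c A B => Matrix.smul_mul c A B)
      Matrix.mul_add (fun c A B => Matrix.mul_smul A c B)) 1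
    fun A B => by simpa using Matrix.l2_opNorm_mul A B

theorem HasDerivWithinAt.matrixMul {A : ℝ → Matrix (Fin l) (Fin m) ℝ}
    {B : ℝ → Matrix (Fin m) (Fin n) ℝ} {A' : Matrix (Fin l) (Fin m) ℝ}
    {B' : Matrix (Fin m) (Fin n) ℝ} {S : Set ℝ} {t : ℝ} (hA : HasDerivWithinAt A A' S t)
    (hB : HasDerivWithinAt B B' S t) :
    HasDerivWithinAt (fun s => A s * B s) (A t * B' + A' * B t) S t :=
  (Matrix.mulCLM l m n).hasDerivWithinAt_of_bilinear hA hB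

theorem HasDerivWithinAt.matrixTranspose {A : ℝ → Matrix (Fin l) (Fin m) ℝ}
    {A' : Matrix (Fin l) (Fin m) ℝ} {S : Set ℝ} {t : ℝ} (hA : HasDerivWithinAt A A' S t) :
    HasDerivWithinAt (fun s => (A s)ᵀ) A'ᵀ S t :=
  ((Matrix.transposeLinearEquiv (Fin l) (Fin m) ℝ
    ℝ).toLinearMap.toContinuousLinearMap.hasFDerivAt.comp_hasDerivWithinAt t hA)

theorem fderiv_apply_eq_sum_matrixGrad (f : Matrix (Fin m) (Fin n) ℝ → ℝ)
    (X H : Matrix (Fin m) (Fin n) ℝ) :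
    fderiv ℝ f X H = ∑ i, ∑ j, matrixGrad f X i j * H i j := by
  conv_lhs => rw [Matrix.matrix_eq_sum_single H]
  simp only [map_sum]
  refine Finset.sum_congr rfl fun i _ => Finset.sum_congr rfl fun j _ => ?_
  rw [show Matrix.single i j (H i j) = H i j • Matrix.single i j (1 : ℝ) by
    rw [Matrix.smul_single, smul_eq_mul, mul_one], map_smul, smul_eq_mul, mul_comm]
  rfl

theorem matrixGrad_comp_mul_left {C : Matrix (Fin l) (Fin n) ℝ → ℝ} (hC : Differentiable ℝ C)
    (B : Matrix (Fin l) (Fin m) ℝ) (V : Matrix (Fin m) (Fin n) ℝ) :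
    matrixGrad (fun V => C (B * V)) V = Bᵀ * matrixGrad C (B * V) := by
  have hd : HasFDerivAt (fun V => C (B * V))
      ((fderiv ℝ C (B * V)).comp (Matrix.mulCLM l m n B)) V :=
    (hC (B * V)).hasFDerivAt.comp V (Matrix.mulCLM l m n B).hasFDerivAt
  ext i j
  rw [matrixGrad, Matrix.of_apply, hd.fderiv]
  change fderiv ℝ C (B * V) (B * Matrix.single i j (1 : ℝ)) = _
  rw [fderiv_apply_eq_sum_matrixGrad, Matrix.mul_apply]
  refine Finset.sum_congr rfl fun k _ => ?_
  rw [Finset.sum_eq_single j]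
  · simp [mul_comm]
  · intro b _ hb
    simp [Matrix.mul_single_apply_of_ne, hb]
  · simp

theorem matrixGrad_comp_mul_right {C : Matrix (Fin l) (Fin n) ℝ → ℝ} (hC : Differentiable ℝ C)
    (B : Matrix (Fin m) (Fin n) ℝ) (V : Matrix (Fin l) (Fin m) ℝ) :
    matrixGrad (fun V => C (V * B)) V = matrixGrad C (V * B) * Bᵀ := by
  have hd : HasFDerivAt (fun V => C (V * B))
      ((fderiv ℝ C (V * B)).comp ((Matrix.mulCLM l m n).flip B)) V :=
    (hC (V * B)).hasFDerivAt.comp V ((Matrix.mulCLM l m n).flip B).hasFDerivAt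
  ext i j
  rw [matrixGrad, Matrix.of_apply, hd.fderiv]
  change fderiv ℝ C (V * B) (Matrix.single i j (1 : ℝ) * B) = _
  rw [fderiv_apply_eq_sum_matrixGrad, Matrix.mul_apply, Finset.sum_eq_single i]
  · refine Finset.sum_congr rfl fun k _ => ?_
    simp
  · intro b _ hb
    refine Finset.sum_eq_zero fun k _ => ?_
    simp [Matrix.single_mul_apply_of_ne, hb]
  · simp

variable {din dout w : ℕ} {C : Matrix (Fin dout) (Fin din) ℝ → ℝ} {T : ℝ}
  {W₁ : ℝ → Matrix (Fin w) (Fin din) ℝ} {W₂ : ℝ → Matrix (Fin dout) (Fin w) ℝ}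

theorem IsGradientFlow.hasDerivWithinAt_fst (h : IsGradientFlow C T W₁ W₂)
    (hC : Differentiable ℝ C) {t : ℝ} (ht : t ∈ Set.Icc 0 T) :
    HasDerivWithinAt W₁ (-((W₂ t)ᵀ * matrixGrad C (W₂ t * W₁ t))) (Set.Icc 0 T) t := by
  have := h.deriv_fst t ht
  rwa [show (fun V => netLoss C V (W₂ t)) = fun V => C (W₂ t * V) from rfl,
    matrixGrad_comp_mul_left hC] at this

theorem IsGradientFlow.hasDerivWithinAt_snd (h : IsGradientFlow C T W₁ W₂)
    (hC : Differentiable ℝ C) {t : ℝ} (ht : t ∈ Set.Icc 0 T) :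
    HasDerivWithinAt W₂ (-(matrixGrad C (W₂ t * W₁ t) * (W₁ t)ᵀ)) (Set.Icc 0 T) t := by
  have := h.deriv_snd t ht
  rwa [show (fun V => netLoss C (W₁ t) V) = fun V => C (V * W₁ t) from rfl,
    matrixGrad_comp_mul_right hC] at this

/-- The imbalance `W₁ W₁ᵀ - W₂ᵀ W₂` is conserved by the gradient flow. -/
theorem IsGradientFlow.imbalance_eq (h : IsGradientFlow C T W₁ W₂) (hC : Differentiable ℝ C)
    {t : ℝ} (ht : t ∈ Set.Icc 0 T) :
    W₁ t * (W₁ t)ᵀ - (W₂ t)ᵀ * W₂ t = W₁ 0 * (W₁ 0)ᵀ - (W₂ 0)ᵀ * W₂ 0 := by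
  have hd : ∀ s ∈ Set.Icc 0 T, HasDerivWithinAt (fun s => W₁ s * (W₁ s)ᵀ - (W₂ s)ᵀ * W₂ s) 0
      (Set.Icc 0 T) s := by
    intro s hs
    have h1 := h.hasDerivWithinAt_fst hC hs
    have h2 := h.hasDerivWithinAt_snd hC hs
    refine ((h1.matrixMul h1.matrixTranspose).fun_sub
      (h2.matrixTranspose.matrixMul h2)).congr_deriv ?_
    simp only [Matrix.transpose_neg, Matrix.transpose_mul, Matrix.transpose_transpose,
      Matrix.mul_neg, Matrix.neg_mul, Matrix.mul_assoc]
    abel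
  refine constant_of_derivWithin_zero (fun s hs => (hd s hs).differentiableWithinAt)
    (fun s hs => (hd s (Set.Ico_subset_Icc_self hs)).derivWithin ?_) t ht
  exact uniqueDiffOn_Icc (hs.1.trans_lt hs.2) s (Set.Ico_subset_Icc_self hs)

theorem IsGradientFlow.hasDerivWithinAt_mul (h : IsGradientFlow C T W₁ W₂)
    (hC : Differentiable ℝ C) {t : ℝ} (ht : t ∈ Set.Icc 0 T) :
    HasDerivWithinAt (fun s => W₂ s * W₁ s)
      (-(W₂ t * (W₂ t)ᵀ * matrixGrad C (W₂ t * W₁ t))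
        - matrixGrad C (W₂ t * W₁ t) * ((W₁ t)ᵀ * W₁ t)) (Set.Icc 0 T) t := by
  convert (h.hasDerivWithinAt_snd hC ht).matrixMul (h.hasDerivWithinAt_fst hC ht) using 1
  simp only [Matrix.mul_neg, Matrix.neg_mul, Matrix.mul_assoc]
  abel

theorem IsGradientFlow.exists_mixed_dynamics (h : IsGradientFlow C T W₁ W₂)
    (hC : Differentiable ℝ C) {t : ℝ} (ht : t ∈ Set.Icc 0 T) {M : ℝ}
    {X₁ : Matrix (Fin din) (Fin din) ℝ} {X₂ : Matrix (Fin dout) (Fin dout) ℝ}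
    (h₁ : ‖(W₁ t)ᵀ * W₁ t - X₁‖ ≤ M) (h₂ : ‖W₂ t * (W₂ t)ᵀ - X₂‖ ≤ M) :
    ∃ E : Matrix (Fin dout) (Fin din) ℝ,
      HasDerivWithinAt (fun s => W₂ s * W₁ s)
        (-(X₂ * matrixGrad C (W₂ t * W₁ t)) - matrixGrad C (W₂ t * W₁ t) * X₁ + E)
        (Set.Icc 0 T) t ∧
      ‖E‖ ≤ 2 * M * ‖matrixGrad C (W₂ t * W₁ t)‖ := by
  set G := matrixGrad C (W₂ t * W₁ t) with hG
  refine ⟨-((W₂ t * (W₂ t)ᵀ - X₂) * G) - G * ((W₁ t)ᵀ * W₁ t - X₁), ?_, ?_⟩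
  · convert h.hasDerivWithinAt_mul hC ht using 1
    rw [← hG, Matrix.sub_mul, Matrix.mul_sub]
    abel
  · calc _ ≤ ‖(W₂ t * (W₂ t)ᵀ - X₂) * G‖ + ‖G * ((W₁ t)ᵀ * W₁ t - X₁)‖ := by
          rw [← norm_neg ((W₂ t * (W₂ t)ᵀ - X₂) * G)]; exact norm_sub_le _ _
      _ ≤ M * ‖G‖ + ‖G‖ * M := by
        gcongr
        · exact (Matrix.l2_opNorm_mul _ _).trans (by gcongr)
        · exact (Matrix.l2_opNorm_mul _ _).trans (by gcongr)
      _ = _ := by ring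

end GradientFlow

/-! ### Isotropic Gaussian families and chi-square concentration. -/

section ChiSquare

/-- With `y = 2l`, its square root bounds the chi-square moment generating function `(1 -
2l)^(-1/2)` by `exp (l + 2l²)`. -/
theorem Real.one_div_one_sub_le_exp {y : ℝ} (h : |y| ≤ 1 / 2) :
    1 / (1 - y) ≤ Real.exp (y + y ^ 2) := by
  obtain ⟨h1, h2⟩ := abs_le.1 h
  rw [div_le_iff₀ (by linarith)]
  rcases le_total 0 y with hy | hy
  · have := Real.quadratic_le_exp_of_nonneg (by positivity : 0 ≤ y + y ^ 2)
    have h3 : (1 + (y + y ^ 2) + (y + y ^ 2) ^ 2 / 2) * (1 - y)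
        ≤ Real.exp (y + y ^ 2) * (1 - y) := by gcongr; linarith
    refine le_trans ?_ h3
    have : 0 ≤ y ^ 2 * ((1 - 2 * y) + y * (1 - y - y ^ 2)) :=
      mul_nonneg (sq_nonneg y) (by nlinarith)
    nlinarith
  · have := Real.add_one_le_exp (y + y ^ 2)
    have h3 : (y + y ^ 2 + 1) * (1 - y) ≤ Real.exp (y + y ^ 2) * (1 - y) := by
      gcongr; linarith
    have : 0 ≤ -y * y ^ 2 := mul_nonneg (by linarith) (sq_nonneg y)
    nlinarith

theorem integral_exp_mul_sq_gaussianReal {v : NNReal} (hv : v ≠ 0) {t : ℝ} (ht : 2 * t * v < 1) :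
    ∫ x, Real.exp (t * x ^ 2) ∂gaussianReal 0 v = √(1 / (1 - 2 * t * v)) := by
  have hv' : (0 : ℝ) < v := by positivity
  rw [integral_gaussianReal_eq_integral_smul hv]
  have e : ∀ x : ℝ, gaussianPDFReal 0 v x • Real.exp (t * x ^ 2)
      = (√(2 * Real.pi * v))⁻¹ * Real.exp (-((1 - 2 * t * v) / (2 * v)) * x ^ 2) := by
    intro x
    rw [gaussianPDFReal, smul_eq_mul, mul_assoc, ← Real.exp_add]
    congr 2
    field_simp
    ring
  simp_rw [e]
  rw [integral_const_mul, integral_gaussian, ← Real.sqrt_inv, ← Real.sqrt_mul (by positivity)]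
  congr 1
  have : 0 < 1 - 2 * t * v := by linarith
  field_simp

variable {Ω : Type*} [MeasurableSpace Ω] {P : Measure Ω} {ι κ : Type*}

/-- A centred jointly Gaussian family with covariance `v • 1`. -/
structure IsIsotropicGaussian [DecidableEq ι] (X : ι → Ω → ℝ) (v : ℝ) (P : Measure Ω) : Prop where
  gaussian : HasGaussianLaw (fun ω i => X i ω) P
  measurable : ∀ i, Measurable (X i)
  mean : ∀ i, ∫ ω, X i ω ∂P = 0
  cov : ∀ i j, cov[X i, X j; P] = if i = j then v else 0

namespace IsIsotropicGaussian

variable [DecidableEq ι] {X : ι → Ω → ℝ} {v : ℝ}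

theorem isProbabilityMeasure (h : IsIsotropicGaussian X v P) : IsProbabilityMeasure P :=
  h.gaussian.isProbabilityMeasure

theorem map_eq (h : IsIsotropicGaussian X v P) (i : ι) :
    P.map (X i) = gaussianReal 0 v.toNNReal := by
  rw [(h.gaussian.eval i).map_eq_gaussianReal, h.mean,
    ← covariance_self (h.measurable i).aemeasurable, h.cov, if_pos rfl]

/-- The nonvanishing half is recorded because it later yields integrability of the exponential of
the whole sum. -/
theorem mgf_sq_le (h : IsIsotropicGaussian X v P) (hv : 0 < v) {l : ℝ} (hl : |l| ≤ 1 / 4) (i : ι) :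
    mgf (fun ω => X i ω ^ 2) P (l / v) ≤ Real.exp (l + 2 * l ^ 2) ∧
      mgf (fun ω => X i ω ^ 2) P (l / v) ≠ 0 := by
  have hl2 := abs_le.1 hl
  have e : mgf (fun ω => X i ω ^ 2) P (l / v) = √(1 / (1 - 2 * l)) := by
    have h1 := integral_exp_mul_sq_gaussianReal (v := v.toNNReal) (t := l / v) (by simpa using hv)
      (by rw [Real.coe_toNNReal _ hv.le]; field_simp; linarith)
    rw [← h.map_eq i, integral_map (h.measurable i).aemeasurable
      (by fun_prop), Real.coe_toNNReal _ hv.le] at h1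
    rw [mgf, h1]
    congr 3
    field_simp
  rw [e]
  have hpos : 0 < 1 / (1 - 2 * l) := one_div_pos.2 (by linarith)
  refine ⟨Real.sqrt_le_iff.2 ⟨(Real.exp_pos _).le, ?_⟩, (Real.sqrt_pos.2 hpos).ne'⟩
  rw [← Real.exp_nat_mul]
  refine (Real.one_div_one_sub_le_exp (y := 2 * l) ?_).trans_eq (by congr 1; push_cast; ring)
  rw [abs_mul, abs_two]; linarith

variable [Fintype ι] [Fintype κ]

theorem cov_sum (h : IsIsotropicGaussian X v P) (a b : ι → ℝ) :
    cov[fun ω => ∑ i, a i * X i ω, fun ω => ∑ i, b i * X i ω; P] = v * ∑ i, a i * b i := by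
  have := h.isProbabilityMeasure
  have hm : ∀ (a : ι → ℝ) i, MemLp (fun ω => a i * X i ω) 2 P := fun a i =>
    (h.gaussian.eval i).memLp_two.const_mul _
  rw [covariance_fun_sum_fun_sum (hm a) (hm b), Finset.mul_sum]
  refine Finset.sum_congr rfl fun i _ => ?_
  simp_rw [covariance_const_mul_left, covariance_const_mul_right, h.cov]
  simp
  ring

theorem integral_sum (h : IsIsotropicGaussian X v P) (a : ι → ℝ) :
    ∫ ω, ∑ i, a i * X i ω ∂P = 0 := by
  have := h.isProbabilityMeasure
  rw [integral_finsetSum _ fun i _ => (h.gaussian.eval i).integrable.const_mul _]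
  refine Finset.sum_eq_zero fun i _ => ?_
  rw [integral_const_mul, h.mean, mul_zero]

theorem hasGaussianLaw_linear (h : IsIsotropicGaussian X v P) (L : κ → ι → ℝ) :
    HasGaussianLaw (fun ω k => ∑ i, L k i * X i ω) P :=
  h.gaussian.map_fun (ContinuousLinearMap.pi fun k =>
    ∑ i, L k i • ContinuousLinearMap.proj (R := ℝ) (φ := fun _ : ι => ℝ) i) |>.congr
    (Filter.Eventually.of_forall fun ω => by ext k; simp)

/-- Linear images with orthogonal coefficient rows of equal length stay isotropic; every Gaussian
vector used below is obtained in this way. -/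
theorem linear [DecidableEq κ] (h : IsIsotropicGaussian X v P) (L : κ → ι → ℝ) {c : ℝ}
    (hL : ∀ k l, ∑ i, L k i * L l i = if k = l then c else 0) :
    IsIsotropicGaussian (fun k ω => ∑ i, L k i * X i ω) (v * c) P where
  gaussian := h.hasGaussianLaw_linear L
  measurable k := Finset.measurable_sum _ fun i _ => (h.measurable i).const_mul _
  mean k := h.integral_sum _
  cov k l := by rw [h.cov_sum, hL]; split_ifs <;> simp

theorem mgf_sum_sq_le (h : IsIsotropicGaussian X v P) (hv : 0 < v) {l : ℝ} (hl : |l| ≤ 1 / 4) :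
    mgf (fun ω => ∑ i, X i ω ^ 2) P (l / v) ≤ Real.exp (Fintype.card ι * (l + 2 * l ^ 2)) ∧
      Integrable (fun ω => Real.exp (l / v * ∑ i, X i ω ^ 2)) P := by
  have hind : iIndepFun X P := h.gaussian.iIndepFun_of_covariance_eq_zero fun i j hij => by
    rw [h.cov, if_neg hij]
  have e : mgf (fun ω => ∑ i, X i ω ^ 2) P (l / v)
      = ∏ i, mgf (fun ω => X i ω ^ 2) P (l / v) := by
    have e1 := (hind.comp (fun _ x => x ^ 2) fun _ => by fun_prop).mgf_sum (t := l / v)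
      (fun i => (h.measurable i).pow_const 2) Finset.univ
    refine Eq.trans ?_ e1
    congr 1
    ext ω
    simp
  constructor
  · rw [e, Real.exp_nat_mul, ← Finset.card_univ, ← Finset.prod_const]
    exact Finset.prod_le_prod (fun i _ => mgf_nonneg) fun i _ => (h.mgf_sq_le hv hl i).1
  · have : mgf (fun ω => ∑ i, X i ω ^ 2) P (l / v) ≠ 0 := by
      rw [e]; exact Finset.prod_ne_zero_iff.2 fun i _ => (h.mgf_sq_le hv hl i).2
    -- A Bochner integral of a nonintegrable function is `0` by convention, so a nonzero value
    -- proves integrability.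
    exact Integrable.of_integral_ne_zero this

/-- Concentration of the squared norm of an isotropic Gaussian vector. -/
theorem measureReal_le (h : IsIsotropicGaussian X v P) (hv : 0 < v) {l : ℝ} (hl0 : 0 ≤ l)
    (hl : l ≤ 1 / 4) (t : ℝ) :
    P.real {ω | t * v ≤ |∑ i, X i ω ^ 2 - Fintype.card ι * v|}
      ≤ 2 * Real.exp (2 * Fintype.card ι * l ^ 2 - l * t) := by
  have := h.isProbabilityMeasure
  have hla : |l| ≤ 1 / 4 := by rwa [abs_of_nonneg hl0]
  have hla' : |-l| ≤ 1 / 4 := by rwa [abs_neg]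
  have up := measure_ge_le_exp_mul_mgf ((Fintype.card ι + t) * v) (div_nonneg hl0 hv.le)
    (h.mgf_sum_sq_le hv hla).2
  have dn := measure_le_le_exp_mul_mgf ((Fintype.card ι - t) * v)
    (div_nonpos_of_nonpos_of_nonneg (neg_nonpos.2 hl0) hv.le) (h.mgf_sum_sq_le hv hla').2
  have hup : Real.exp (-(l / v) * ((Fintype.card ι + t) * v))
      * mgf (fun ω => ∑ i, X i ω ^ 2) P (l / v)
        ≤ Real.exp (2 * Fintype.card ι * l ^ 2 - l * t) := by
    calc _ ≤ Real.exp (-(l / v) * ((Fintype.card ι + t) * v))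
          * Real.exp (Fintype.card ι * (l + 2 * l ^ 2)) := by
            gcongr; exact (h.mgf_sum_sq_le hv hla).1
      _ = _ := by rw [← Real.exp_add]; congr 1; field_simp; ring
  have hdn : Real.exp (-(-l / v) * ((Fintype.card ι - t) * v))
      * mgf (fun ω => ∑ i, X i ω ^ 2) P (-l / v)
        ≤ Real.exp (2 * Fintype.card ι * l ^ 2 - l * t) := by
    calc _ ≤ Real.exp (-(-l / v) * ((Fintype.card ι - t) * v))
          * Real.exp (Fintype.card ι * (-l + 2 * (-l) ^ 2)) := by
            gcongr; exact (h.mgf_sum_sq_le hv hla').1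
      _ = _ := by rw [← Real.exp_add]; congr 1; field_simp; ring
  have hsub : {ω | t * v ≤ |∑ i, X i ω ^ 2 - Fintype.card ι * v|}
      ⊆ {ω | (Fintype.card ι + t) * v ≤ ∑ i, X i ω ^ 2}
        ∪ {ω | ∑ i, X i ω ^ 2 ≤ (Fintype.card ι - t) * v} := by
    intro ω hω
    rcases le_abs.1 (show t * v ≤ |_| from hω) with h1 | h1
    · exact Or.inl (Set.mem_ofPred.2 (by linarith))
    · exact Or.inr (Set.mem_ofPred.2 (by linarith))
  calc _ ≤ _ := measureReal_mono hsub
    _ ≤ _ := measureReal_union_le _ _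
    _ ≤ _ := by rw [two_mul]; exact add_le_add (up.trans hup) (dn.trans hdn)

end IsIsotropicGaussian

end ChiSquare

/-! ### The initial weights form an isotropic Gaussian family. -/

section InitialLaw

theorem isGaussian_measurePi {ι : Type*} [Fintype ι] {E : Type*} [NormedAddCommGroup E]
    [NormedSpace ℝ E] [MeasurableSpace E] [BorelSpace E] [CompleteSpace E]
    [SecondCountableTopology E] (μ : ι → Measure E) [∀ i, IsGaussian (μ i)] :
    IsGaussian (Measure.pi μ) := by
  have h : HasGaussianLaw (fun (ω : ι → E) i => ω i) (Measure.pi μ) := by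
    refine iIndepFun.hasGaussianLaw (fun i => ⟨?_⟩)
      (iIndepFun_pi (μ := μ) (X := fun i x => x) fun i => aemeasurable_id)
    rw [(measurePreserving_eval μ i).map_eq]
    infer_instance
  have := h.isGaussian_map
  rwa [show (fun (ω : ι → E) i => ω i) = id from rfl, Measure.map_id] at this

instance isGaussian_gaussianLaw (m n : ℕ) (σ : ℝ) : IsGaussian (gaussianLaw m n σ) :=
  have := isGaussian_measurePi fun _ : Fin n => gaussianReal 0 (σ ^ 2).toNNReal
  isGaussian_measurePi _

instance isGaussian_initLaw (din w dout : ℕ) (σ : ℝ) : IsGaussian (initLaw din w dout σ) := by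
  unfold initLaw; infer_instance

theorem measurePreserving_eval_gaussianLaw (m n : ℕ) (σ : ℝ) (i : Fin m) (j : Fin n) :
    MeasurePreserving (fun θ : Fin m → Fin n → ℝ => θ i j) (gaussianLaw m n σ)
      (gaussianReal 0 (σ ^ 2).toNNReal) :=
  (measurePreserving_eval (fun _ : Fin n => gaussianReal 0 (σ ^ 2).toNNReal) j).comp
    (measurePreserving_eval
      (fun _ : Fin m => Measure.pi fun _ : Fin n => gaussianReal 0 (σ ^ 2).toNNReal) i)

theorem hasGaussianLaw_entries (m n : ℕ) (σ : ℝ) :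
    HasGaussianLaw (fun (θ : Fin m → Fin n → ℝ) (p : Fin m × Fin n) => θ p.1 p.2)
      (gaussianLaw m n σ) :=
  IsGaussian.hasGaussianLaw_id.map_fun (ContinuousLinearMap.pi fun p : Fin m × Fin n =>
    (ContinuousLinearMap.proj (R := ℝ) (φ := fun _ : Fin n => ℝ) p.2).comp
      (ContinuousLinearMap.proj (R := ℝ) (φ := fun _ : Fin m => Fin n → ℝ) p.1))

theorem hasGaussianLaw_eval_measurePi (n : ℕ) (σ : ℝ) (j : Fin n) :
    HasGaussianLaw (fun x : Fin n → ℝ => x j)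
      (Measure.pi fun _ : Fin n => gaussianReal 0 (σ ^ 2).toNNReal) where
  isGaussian_map := by
    rw [(measurePreserving_eval (fun _ : Fin n => gaussianReal 0 (σ ^ 2).toNNReal) j).map_eq]
    infer_instance

theorem measurable_entry (m n : ℕ) (p : Fin m × Fin n) :
    Measurable fun θ : Fin m → Fin n → ℝ => θ p.1 p.2 := by
  fun_prop

theorem isIsotropicGaussian_gaussianLaw (m n : ℕ) (σ : ℝ) :
    IsIsotropicGaussian (fun (p : Fin m × Fin n) (θ : Fin m → Fin n → ℝ) => θ p.1 p.2) (σ ^ 2)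
      (gaussianLaw m n σ) where
  gaussian := hasGaussianLaw_entries m n σ
  measurable p := by fun_prop
  mean p := by
    have h := measurePreserving_eval_gaussianLaw m n σ p.1 p.2
    have := integral_map (μ := gaussianLaw m n σ) h.measurable.aemeasurable
      (f := fun x : ℝ => x) (by fun_prop)
    rw [h.map_eq, integral_id_gaussianReal] at this
    exact this.symm
  cov p q := by
    have hL : ∀ r : Fin m × Fin n, MemLp (fun θ : Fin m → Fin n → ℝ => θ r.1 r.2) 2
      (gaussianLaw m n σ) := fun r => ((hasGaussianLaw_entries m n σ).eval r).memLp_two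
    obtain ⟨i, j⟩ := p
    obtain ⟨i', j'⟩ := q
    split_ifs with hpq
    · obtain ⟨rfl, rfl⟩ := Prod.mk.inj hpq
      have h := measurePreserving_eval_gaussianLaw m n σ i j
      rw [covariance_self h.measurable.aemeasurable]
      have := variance_map (μ := gaussianLaw m n σ) (X := fun x : ℝ => x) (by fun_prop)
        h.measurable.aemeasurable
      rw [h.map_eq, variance_fun_id_gaussianReal, Real.coe_toNNReal _ (sq_nonneg σ)] at this
      exact this.symm
    · by_cases hi : i = i'
      · subst hi
        have hj : j ≠ j' := fun h => hpq (by rw [h])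
        have h1 := (iIndepFun_pi (μ := fun _ : Fin n => gaussianReal 0 (σ ^ 2).toNNReal)
          (X := fun _ x => x) fun _ => aemeasurable_id).indepFun hj
        have hp := measurePreserving_eval (fun _ : Fin m => Measure.pi fun _ : Fin n =>
          gaussianReal 0 (σ ^ 2).toNNReal) i
        have hm : ∀ k : Fin n, Measurable fun x : Fin n → ℝ => x k := fun k => by fun_prop
        have e := covariance_map_fun (μ := gaussianLaw m n σ) (Z := fun θ => θ i)
          (X := fun x : Fin n → ℝ => x j) (Y := fun x : Fin n → ℝ => x j')
          (hm j).aestronglyMeasurable (hm j').aestronglyMeasurable hp.measurable.aemeasurable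
        rw [gaussianLaw, hp.map_eq] at e
        rw [gaussianLaw]
        refine e.symm.trans (h1.covariance_eq_zero ?_ ?_)
        · exact (hasGaussianLaw_eval_measurePi n σ j).memLp_two
        · exact (hasGaussianLaw_eval_measurePi n σ j').memLp_two
      · refine IndepFun.covariance_eq_zero ?_ (hL (i, j)) (hL (i', j'))
        exact ((iIndepFun_pi (μ := fun _ : Fin m => Measure.pi fun _ : Fin n =>
          gaussianReal 0 (σ ^ 2).toNNReal) (X := fun _ x => x)
            fun _ => aemeasurable_id).indepFun hi).comp
          (measurable_pi_apply j) (measurable_pi_apply j')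

theorem isIsotropicGaussian_initLaw (din w dout : ℕ) (σ : ℝ) :
    IsIsotropicGaussian (fun (p : (Fin w × Fin din) ⊕ (Fin dout × Fin w))
      (θ : (Fin w → Fin din → ℝ) × (Fin dout → Fin w → ℝ)) =>
        Sum.elim (fun p => θ.1 p.1 p.2) (fun p => θ.2 p.1 p.2) p) (σ ^ 2)
      (initLaw din w dout σ) where
  gaussian := by
    have h : IsGaussian (initLaw din w dout σ) := inferInstance
    have := h.hasGaussianLaw_id.map_fun (ContinuousLinearMap.pi
      (fun p : (Fin w × Fin din) ⊕ (Fin dout × Fin w) => Sum.elim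
        (fun p => ((ContinuousLinearMap.proj (R := ℝ) (φ := fun _ : Fin din => ℝ) p.2).comp
          (ContinuousLinearMap.proj (R := ℝ) (φ := fun _ : Fin w => Fin din → ℝ) p.1)).comp
          (ContinuousLinearMap.fst ℝ _ _))
        (fun p => ((ContinuousLinearMap.proj (R := ℝ) (φ := fun _ : Fin w => ℝ) p.2).comp
          (ContinuousLinearMap.proj (R := ℝ) (φ := fun _ : Fin dout => Fin w → ℝ) p.1)).comp
          (ContinuousLinearMap.snd ℝ _ _)) p))
    refine this.congr (Filter.Eventually.of_forall fun θ => ?_)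
    ext p
    cases p <;> rfl
  measurable p := by cases p <;> simp <;> fun_prop
  mean p := by
    rw [initLaw]
    cases p with
    | inl p =>
      have h := (measurePreserving_fst (μ := gaussianLaw w din σ) (ν := gaussianLaw dout w σ))
      have := integral_map (μ := initLaw din w dout σ) h.measurable.aemeasurable
        (f := fun θ : Fin w → Fin din → ℝ => θ p.1 p.2) (measurable_entry _ _ p).aestronglyMeasurable
      rw [initLaw, h.map_eq, (isIsotropicGaussian_gaussianLaw w din σ).mean p] at this
      exact this.symm
    | inr p =>
      have h := (measurePreserving_snd (μ := gaussianLaw w din σ) (ν := gaussianLaw dout w σ))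
      have := integral_map (μ := initLaw din w dout σ) h.measurable.aemeasurable
        (f := fun θ : Fin dout → Fin w → ℝ => θ p.1 p.2) (measurable_entry _ _ p).aestronglyMeasurable
      rw [initLaw, h.map_eq, (isIsotropicGaussian_gaussianLaw dout w σ).mean p] at this
      exact this.symm
  cov p q := by
    rw [initLaw]
    have hf := (measurePreserving_fst (μ := gaussianLaw w din σ) (ν := gaussianLaw dout w σ))
    have hs := (measurePreserving_snd (μ := gaussianLaw w din σ) (ν := gaussianLaw dout w σ))
    have hL1 : ∀ r : Fin w × Fin din, MemLp (fun θ : Fin w → Fin din → ℝ => θ r.1 r.2) 2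
      (gaussianLaw w din σ) := fun r => ((hasGaussianLaw_entries _ _ σ).eval r).memLp_two
    have hL2 : ∀ r : Fin dout × Fin w, MemLp (fun θ : Fin dout → Fin w → ℝ => θ r.1 r.2) 2
      (gaussianLaw dout w σ) := fun r => ((hasGaussianLaw_entries _ _ σ).eval r).memLp_two
    cases p with
    | inl p =>
      cases q with
      | inl q =>
        have := covariance_map_fun (μ := initLaw din w dout σ) (Z := Prod.fst)
          (X := fun θ : Fin w → Fin din → ℝ => θ p.1 p.2)
          (Y := fun θ : Fin w → Fin din → ℝ => θ q.1 q.2) 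
          (measurable_entry _ _ p).aestronglyMeasurable (measurable_entry _ _ q).aestronglyMeasurable
          (by fun_prop)
        rw [initLaw, hf.map_eq, (isIsotropicGaussian_gaussianLaw w din σ).cov p q] at this
        simpa using this.symm
      | inr q => simpa using covariance_fst_snd_prod (hL1 p) (hL2 q)
    | inr p =>
      cases q with
      | inl q =>
        rw [covariance_comm]
        simpa using covariance_fst_snd_prod (hL1 q) (hL2 p)
      | inr q =>
        have := covariance_map_fun (μ := initLaw din w dout σ) (Z := Prod.snd)
          (X := fun θ : Fin dout → Fin w → ℝ => θ p.1 p.2)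
          (Y := fun θ : Fin dout → Fin w → ℝ => θ q.1 q.2) 
          (measurable_entry _ _ p).aestronglyMeasurable (measurable_entry _ _ q).aestronglyMeasurable
          (by fun_prop)
        rw [initLaw, hs.map_eq, (isIsotropicGaussian_gaussianLaw dout w σ).cov p q] at this
        simpa using this.symm

end InitialLaw

/-! ### Nets of the sphere and operator norms. -/

section SphereNet

/-- The unit sphere of a Euclidean space has a `1/2`-net of cardinality exponential in the
dimension. -/
theorem exists_half_net_sphere (E : Type*) [NormedAddCommGroup E] [NormedSpace ℝ E]
    [FiniteDimensional ℝ E] :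
    ∃ N : Finset E, N.card ≤ 5 ^ Module.finrank ℝ E ∧ (∀ y ∈ N, ‖y‖ = 1) ∧
      ∀ x : E, ‖x‖ = 1 → ∃ y ∈ N, ‖y - x‖ ≤ 1 / 2 := by
  classical
  let S : Set ℕ := {k | ∃ N : Finset E, (∀ y ∈ N, ‖y‖ = 1) ∧
    (∀ y ∈ N, ∀ z ∈ N, y ≠ z → 1 / 2 ≤ ‖y - z‖) ∧ N.card = k}
  have hS : ∀ k ∈ S, k ≤ 5 ^ Module.finrank ℝ E := by
    rintro k ⟨N, h1, h2, rfl⟩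
    -- Doubling turns a `1/2`-separated subset of the unit sphere into a `1`-separated subset of the
    -- ball of radius `2`, the normalization in which the cardinality is at most `5 ^ dim`.
    have hinj : Function.Injective fun y : E => (2 : ℝ) • y := smul_right_injective E two_ne_zero
    rw [← Finset.card_image_of_injective N hinj]
    refine Besicovitch.card_le_of_separated _ (fun c hc => ?_) (fun c hc e he hce => ?_)
    · obtain ⟨y, hy, rfl⟩ := Finset.mem_image.1 hc
      simp [norm_smul, h1 y hy]
    · obtain ⟨y, hy, rfl⟩ := Finset.mem_image.1 hc
      obtain ⟨z, hz, rfl⟩ := Finset.mem_image.1 he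
      rw [← smul_sub, norm_smul, Real.norm_two]
      have := h2 y hy z hz fun h => hce (by rw [h])
      linarith
  have hb : BddAbove S := ⟨_, hS⟩
  -- A separated set of largest cardinality is a net: an uncovered point could be added to it.
  obtain ⟨N, h1, h2, h3⟩ := Nat.sSup_mem (s := S) ⟨0, ∅, by simp, by simp, by simp⟩ hb
  refine ⟨N, h3 ▸ hS _ (Nat.sSup_mem ⟨0, ∅, by simp, by simp, by simp⟩ hb), h1, fun x hx => ?_⟩
  by_contra! hcon
  have hxN : x ∉ N := fun h => by
    have := hcon x h
    rw [sub_self, norm_zero] at this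
    linarith
  have hmem : N.card + 1 ∈ S := by
    refine ⟨insert x N, ?_, ?_, Finset.card_insert_of_notMem hxN⟩
    · simpa [hx] using h1
    · intro y hy z hz hyz
      rcases Finset.mem_insert.1 hy with rfl | hy' <;>
        rcases Finset.mem_insert.1 hz with rfl | hz'
      · exact absurd rfl hyz
      · rw [norm_sub_rev]; exact (hcon z hz').le
      · exact (hcon y hy').le
      · exact h2 y hy' z hz' hyz
  have := le_csSup hb hmem
  omega

variable {p : Type*} [Fintype p] [DecidableEq p]

/-- The operator norm of a symmetric matrix is controlled by its quadratic form on a `1/2`-net. -/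
theorem Matrix.norm_le_of_half_net {M : Matrix p p ℝ} (hM : Mᵀ = M) {b : ℝ} (hb : 0 ≤ b)
    {N : Finset (EuclideanSpace ℝ p)} (hN : ∀ y ∈ N, ‖y‖ = 1)
    (hnet : ∀ x : EuclideanSpace ℝ p, ‖x‖ = 1 → ∃ y ∈ N, ‖y - x‖ ≤ 1 / 2)
    (h : ∀ y ∈ N, |y.ofLp ⬝ᵥ M *ᵥ y.ofLp| ≤ b) : ‖M‖ ≤ 2 * b := by
  rcases isEmpty_or_nonempty p with hp | hp
  · rw [Subsingleton.elim M 0, norm_zero]; positivity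
  obtain ⟨x₀, l, hx₀, hl, hln⟩ := Matrix.exists_mulVec_eq_smul_abs_eq_norm hM
  have hx₀' : ‖WithLp.toLp 2 x₀‖ ≠ 0 := by
    rw [norm_ne_zero_iff]
    exact fun h0 => hx₀ (by simpa using h0)
  set r := ‖WithLp.toLp 2 x₀‖
  obtain ⟨y, hy, hyx⟩ := hnet (r⁻¹ • WithLp.toLp 2 x₀) (by
    rw [norm_smul, norm_inv, Real.norm_of_nonneg (norm_nonneg _), inv_mul_cancel₀ hx₀'])
  set x := r⁻¹ • WithLp.toLp 2 x₀ with hx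
  have hMx : M *ᵥ x.ofLp = l • x.ofLp := by
    simp only [hx, WithLp.ofLp_smul, Matrix.mulVec_smul, hl]
    rw [smul_comm]
  have hxx : x.ofLp ⬝ᵥ x.ofLp = 1 := by
    rw [← norm_toLp_sq_eq]
    simp [hx, norm_smul, r, inv_mul_cancel₀ hx₀']
  have hyy : y.ofLp ⬝ᵥ y.ofLp = 1 := by
    rw [← norm_toLp_sq_eq]; simp [hN y hy]
  set z := (y - x).ofLp with hz
  have hzz : z ⬝ᵥ z ≤ 1 / 4 := by
    rw [← norm_toLp_sq_eq]
    calc ‖y - x‖ ^ 2 ≤ (1 / 2) ^ 2 := pow_le_pow_left₀ (norm_nonneg _) hyx 2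
      _ = _ := by norm_num
  have hyz : y.ofLp = x.ofLp + z := by simp [hz]
  -- Since `x` and `y` are both unit vectors, the cross term is of second order in `z`. The form at
  -- `y` thus differs from `l` by at most `2‖M‖ |z|² ≤ ‖M‖ / 2`, so a `1/2`-net is fine enough.
  have hxz : 2 * (x.ofLp ⬝ᵥ z) = -(z ⬝ᵥ z) := by
    have := hyy
    rw [hyz, add_dotProduct, dotProduct_add, dotProduct_add, hxx, dotProduct_comm z] at this
    linarith
  have hMz : x.ofLp ⬝ᵥ M *ᵥ z = l * (x.ofLp ⬝ᵥ z) := by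
    rw [Matrix.dotProduct_mulVec, ← Matrix.mulVec_transpose, hM, hMx, smul_dotProduct, smul_eq_mul]
  have e : y.ofLp ⬝ᵥ M *ᵥ y.ofLp = l * (1 - z ⬝ᵥ z) + z ⬝ᵥ M *ᵥ z := by
    rw [hyz, Matrix.mulVec_add, add_dotProduct, dotProduct_add, dotProduct_add, hMx, hMz,
      dotProduct_smul, dotProduct_smul, hxx, dotProduct_comm z, smul_eq_mul, smul_eq_mul]
    linear_combination l * hxz
  have h1 := h y hy
  have h2 := Matrix.abs_dotProduct_mulVec_le M z
  have hz0 := dotProduct_self_nonneg' z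
  have h3 : |l * (1 - z ⬝ᵥ z)| ≤ b + ‖M‖ * (z ⬝ᵥ z) := by
    have : l * (1 - z ⬝ᵥ z) = y.ofLp ⬝ᵥ M *ᵥ y.ofLp - z ⬝ᵥ M *ᵥ z := by rw [e]; ring
    rw [this]
    exact (abs_sub _ _).trans (add_le_add h1 h2)
  rw [abs_mul, hln, abs_of_nonneg (by linarith)] at h3
  nlinarith [norm_nonneg M]

end SphereNet

/-! ### The stacked initial weights are nearly a multiple of an isometry. -/

section StackedConcentration

variable {din dout w : ℕ}

/-- Distinct rows of the stacked matrix involve disjoint sets of weights, so the coefficient vectors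
are orthogonal, each of squared length `y ⬝ᵥ y`. -/
theorem isIsotropicGaussian_stackedWeights_mulVec (σ : ℝ) (y : Fin din ⊕ Fin dout → ℝ) :
    IsIsotropicGaussian (fun i (θ : (Fin w → Fin din → ℝ) × (Fin dout → Fin w → ℝ)) =>
      (stackedWeights (Matrix.of θ.1) (Matrix.of θ.2) *ᵥ y) i) (σ ^ 2 * (y ⬝ᵥ y))
      (initLaw din w dout σ) := by
  let L : Fin w → (Fin w × Fin din) ⊕ (Fin dout × Fin w) → ℝ := fun i =>
    Sum.elim (fun q => if q.1 = i then y (Sum.inl q.2) else 0)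
      (fun q => if q.2 = i then y (Sum.inr q.1) else 0)
  have h := (isIsotropicGaussian_initLaw din w dout σ).linear L (c := y ⬝ᵥ y) fun i k => by
    simp only [L, Fintype.sum_sum_type, Sum.elim_inl, Sum.elim_inr, Fintype.sum_prod_type]
    rw [Finset.sum_comm (s := (Finset.univ : Finset (Fin w))) (t := (Finset.univ : Finset (Fin din)))]
    split_ifs with hik
    · subst hik
      simp [dotProduct, Fintype.sum_sum_type]
    · simp [Ne.symm hik]
  convert h using 3 with i θ
  simp only [L, Fintype.sum_sum_type, Sum.elim_inl, Sum.elim_inr, Fintype.sum_prod_type,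
    Matrix.mulVec, dotProduct, stackedWeights, Matrix.fromCols_apply_inl,
    Matrix.fromCols_apply_inr, Matrix.transpose_apply, Matrix.of_apply, ite_mul, zero_mul]
  rw [Finset.sum_comm (s := (Finset.univ : Finset (Fin w))) (t := (Finset.univ : Finset (Fin din)))]
  simp [mul_comm]

/-- With overwhelming probability the stacked initial weights are nearly a multiple of an
isometry. -/
theorem measureReal_norm_stackedWeights_gram_sub_le {σ : ℝ} (hσ : 0 < σ) (hd : 0 < max din dout)
    (hw : max din dout ≤ w) :
    (initLaw din w dout σ).real {θ | ¬ ‖(stackedWeights (Matrix.of θ.1) (Matrix.of θ.2))ᵀ *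
      stackedWeights (Matrix.of θ.1) (Matrix.of θ.2) - (σ ^ 2 * w) • 1‖
        ≤ 42 * √((max din dout : ℕ) / (w : ℝ)) * (σ ^ 2 * w)}
      ≤ 2 * Real.exp (-(max din dout : ℕ)) := by
  set d := max din dout with hddef
  have hw0 : (0 : ℝ) < w := by exact_mod_cast hd.trans_le hw
  have hdw : (d : ℝ) ≤ w := by exact_mod_cast hw
  set ε := √((d : ℝ) / w) with hε
  have hε0 : 0 ≤ ε := Real.sqrt_nonneg _
  have hε1 : ε ≤ 1 := Real.sqrt_le_one.2 (div_le_one_of_le₀ hdw hw0.le)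
  have hε2 : w * ε ^ 2 = d := by
    rw [hε, Real.sq_sqrt (by positivity)]; field_simp
  obtain ⟨N, hNc, hN1, hNnet⟩ := exists_half_net_sphere (EuclideanSpace ℝ (Fin din ⊕ Fin dout))
  let B : EuclideanSpace ℝ (Fin din ⊕ Fin dout) →
      Set ((Fin w → Fin din → ℝ) × (Fin dout → Fin w → ℝ)) := fun y =>
    {θ | 21 * ε * w * σ ^ 2 ≤
      |∑ i, (stackedWeights (Matrix.of θ.1) (Matrix.of θ.2) *ᵥ y.ofLp) i ^ 2 - w * σ ^ 2|}
  have hB : ∀ y ∈ N, (initLaw din w dout σ).real (B y) ≤ 2 * Real.exp (-5 * d) := by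
    intro y hy
    have h := isIsotropicGaussian_stackedWeights_mulVec (w := w) σ y.ofLp
    have hyy : y.ofLp ⬝ᵥ y.ofLp = 1 := by rw [← norm_toLp_sq_eq]; simp [hN1 y hy]
    rw [hyy, mul_one] at h
    -- As `w ε² = d`, the exponent is `(1/8 - 21/4) d ≤ -5 d`. This beats the net, of size at most
    -- `5 ^ (2d) ≤ exp (4d)`; the `42` is `21` doubled by the net argument.
    have := h.measureReal_le (by positivity) (l := ε / 4) (by positivity) (by linarith)
      (21 * ε * w)
    rw [Fintype.card_fin] at this
    refine this.trans ?_
    gcongr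
    have : 0 ≤ (d : ℝ) := by positivity
    nlinarith
  have hsub : {θ : (Fin w → Fin din → ℝ) × (Fin dout → Fin w → ℝ) |
      ¬ ‖(stackedWeights (Matrix.of θ.1) (Matrix.of θ.2))ᵀ *
        stackedWeights (Matrix.of θ.1) (Matrix.of θ.2) - (σ ^ 2 * w) • 1‖
        ≤ 42 * ε * (σ ^ 2 * w)} ⊆ ⋃ y ∈ N, B y := by
    intro θ hθ
    by_contra hcon
    refine hθ ?_
    set Z := stackedWeights (Matrix.of θ.1) (Matrix.of θ.2)
    have := Matrix.norm_le_of_half_net (M := Zᵀ * Z - (σ ^ 2 * w) • 1) (b := 21 * ε * w * σ ^ 2)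
      (by simp [Matrix.transpose_sub, Matrix.transpose_mul]) (by positivity) hN1 hNnet
      fun y hy => by
        have hy' : θ ∉ B y := fun h => hcon (Set.mem_biUnion hy h)
        have hyy : y.ofLp ⬝ᵥ y.ofLp = 1 := by rw [← norm_toLp_sq_eq]; simp [hN1 y hy]
        have hlt := not_le.1 (fun h => hy' (Set.mem_ofPred.2 h))
        rw [Matrix.sub_mulVec, dotProduct_sub, Matrix.dotProduct_transpose_mul_self_mulVec,
          Matrix.smul_mulVec, Matrix.one_mulVec, dotProduct_smul, hyy, smul_eq_mul, mul_one,
          mul_comm (σ ^ 2) (w : ℝ)]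
        simpa only [dotProduct, ← pow_two] using hlt.le
    refine this.trans_eq (by ring)
  calc _ ≤ (initLaw din w dout σ).real (⋃ y ∈ N, B y) :=
        measureReal_mono hsub (measure_ne_top _ _)
    _ ≤ ∑ y ∈ N, (initLaw din w dout σ).real (B y) := measureReal_biUnion_finset_le _ _
    _ ≤ ∑ y ∈ N, 2 * Real.exp (-5 * d) := Finset.sum_le_sum hB
    _ = N.card * (2 * Real.exp (-5 * d)) := by rw [Finset.sum_const, nsmul_eq_mul]
    _ ≤ Real.exp (4 * d) * (2 * Real.exp (-5 * d)) := by
      gcongr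
      have h1 : (N.card : ℝ) ≤ (5 : ℝ) ^ (2 * d) := by
        have h2 : N.card ≤ 5 ^ (2 * d) := by
          refine hNc.trans (Nat.pow_le_pow_right (by norm_num) ?_)
          rw [finrank_euclideanSpace, Fintype.card_sum, Fintype.card_fin, Fintype.card_fin]
          have := le_max_left din dout
          have := le_max_right din dout
          omega
        exact_mod_cast h2
      refine h1.trans ?_
      have h5 : (5 : ℝ) ≤ Real.exp 2 := by
        have h := Real.quadratic_le_exp_of_nonneg (show (0 : ℝ) ≤ 2 by norm_num)
        norm_num at h
        exact h
      calc (5 : ℝ) ^ (2 * d) ≤ Real.exp 2 ^ (2 * d) := by gcongr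
        _ = Real.exp (4 * d) := by rw [← Real.exp_nat_mul]; congr 1; push_cast; ring
    _ = 2 * Real.exp (-d) := by
      rw [mul_left_comm, ← Real.exp_add]; congr 2; ring

end StackedConcentration

/-! ### Independence of `W v` and the rows of `W` projected orthogonally to `v`. -/

section GramCorrelation

/-- Linear images of an isotropic Gaussian family are jointly Gaussian, so orthogonality of
coefficients, being zero covariance, gives independence. -/
theorem IsIsotropicGaussian.indepFun_linear {Ω : Type*} [MeasurableSpace Ω] {P : Measure Ω}
    {ι κ κ' : Type*} [Fintype ι] [DecidableEq ι] [Fintype κ] [Fintype κ'] {X : ι → Ω → ℝ} {v : ℝ}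
    (h : IsIsotropicGaussian X v P) (L : κ → ι → ℝ) (L' : κ' → ι → ℝ)
    (hL : ∀ k k', ∑ i, L k i * L' k' i = 0) :
    IndepFun (fun ω k => ∑ i, L k i * X i ω) (fun ω k => ∑ i, L' k i * X i ω) P := by
  refine HasGaussianLaw.indepFun_of_covariance_eval (X := fun k ω => ∑ i, L k i * X i ω)
    (Y := fun k ω => ∑ i, L' k i * X i ω) ?_ fun k k' => by rw [h.cov_sum, hL, mul_zero]
  refine (h.gaussian.map_fun ((ContinuousLinearMap.pi fun k =>
    ∑ i, L k i • ContinuousLinearMap.proj (R := ℝ) (φ := fun _ : ι => ℝ) i).prod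
    (ContinuousLinearMap.pi fun k =>
      ∑ i, L' k i • ContinuousLinearMap.proj (R := ℝ) (φ := fun _ : ι => ℝ) i))).congr
    (Filter.Eventually.of_forall fun ω => ?_)
  ext k <;> simp

/-- A jointly measurable event all of whose sections have small probability has small
probability. -/
theorem measure_prod_le_of_forall_section_le {α β : Type*} [MeasurableSpace α] [MeasurableSpace β]
    {μ : Measure α} {ν : Measure β} [IsProbabilityMeasure μ] [IsProbabilityMeasure ν]
    {B : Set (α × β)} (hB : MeasurableSet B) {c : ℝ} (hc : ∀ a, ν.real (Prod.mk a ⁻¹' B) ≤ c) :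
    (μ.prod ν).real B ≤ c := by
  have hc0 : 0 ≤ c := 
    measureReal_nonneg.trans (hc (nonempty_of_isProbabilityMeasure μ).some)
  refine ENNReal.toReal_le_of_le_ofReal hc0 ?_
  rw [Measure.prod_apply hB]
  calc ∫⁻ a, ν (Prod.mk a ⁻¹' B) ∂μ ≤ ∫⁻ _, ENNReal.ofReal c ∂μ := by
        refine lintegral_mono fun a => ?_
        rw [← ENNReal.ofReal_toReal (measure_ne_top ν (Prod.mk a ⁻¹' B))]
        exact ENNReal.ofReal_le_ofReal (hc a)
    _ = ENNReal.ofReal c := by simp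

variable {k w : ℕ}

theorem isIsotropicGaussian_mulVec (σ : ℝ) (v : Fin w → ℝ) :
    IsIsotropicGaussian (fun i (θ : Fin k → Fin w → ℝ) => (Matrix.of θ *ᵥ v) i)
      (σ ^ 2 * (v ⬝ᵥ v)) (gaussianLaw k w σ) := by
  have h := (isIsotropicGaussian_gaussianLaw k w σ).linear
    (fun (i : Fin k) (q : Fin k × Fin w) => if q.1 = i then v q.2 else 0) (c := v ⬝ᵥ v)
    fun i j => by
      simp only [Fintype.sum_prod_type]
      split_ifs with hij
      · subst hij; rw [Finset.sum_eq_single i] <;> simp +contextual [dotProduct]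
      · refine Finset.sum_eq_zero fun a _ => Finset.sum_eq_zero fun b _ => ?_
        by_cases ha : a = i
        · subst ha; simp [hij]
        · simp [ha]
  convert h using 3 with i θ
  simp only [Fintype.sum_prod_type, Matrix.mulVec, dotProduct, Matrix.of_apply]
  rw [Finset.sum_eq_single i] <;> simp +contextual [mul_comm]

theorem isIsotropicGaussian_transpose_mulVec (σ : ℝ) (g : Fin k → ℝ) :
    IsIsotropicGaussian (fun j (θ : Fin k → Fin w → ℝ) => ((Matrix.of θ)ᵀ *ᵥ g) j)
      (σ ^ 2 * (g ⬝ᵥ g)) (gaussianLaw k w σ) := by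
  have h := (isIsotropicGaussian_gaussianLaw k w σ).linear
    (fun (j : Fin w) (q : Fin k × Fin w) => if q.2 = j then g q.1 else 0) (c := g ⬝ᵥ g)
    fun i j => by
      simp only [Fintype.sum_prod_type]
      split_ifs with hij
      · subst hij
        refine Finset.sum_congr rfl fun a _ => ?_
        rw [Finset.sum_eq_single i] <;> simp +contextual
      · refine Finset.sum_eq_zero fun a _ => Finset.sum_eq_zero fun b _ => ?_
        by_cases ha : b = i
        · subst ha; simp [hij]
        · simp [ha]
  convert h using 3 with j θ
  simp only [Fintype.sum_prod_type, Matrix.mulVec, dotProduct, Matrix.of_apply,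
    Matrix.transpose_apply]
  refine Finset.sum_congr rfl fun a _ => ?_
  rw [Finset.sum_eq_single j] <;> simp +contextual [mul_comm]

theorem isIsotropicGaussian_bilinear (σ : ℝ) (g : Fin k → ℝ) (v : Fin w → ℝ) :
    IsIsotropicGaussian (fun (_ : Unit) (θ : Fin k → Fin w → ℝ) => g ⬝ᵥ Matrix.of θ *ᵥ v)
      (σ ^ 2 * ((g ⬝ᵥ g) * (v ⬝ᵥ v))) (gaussianLaw k w σ) := by
  have h := (isIsotropicGaussian_gaussianLaw k w σ).linear
    (fun (_ : Unit) (q : Fin k × Fin w) => g q.1 * v q.2) (c := (g ⬝ᵥ g) * (v ⬝ᵥ v))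
    fun _ _ => by
      simp only [Fintype.sum_prod_type, dotProduct, Finset.sum_mul_sum, if_true]
      exact Finset.sum_congr rfl fun a _ => Finset.sum_congr rfl fun b _ => by ring
  convert h using 3 with j θ
  simp only [Fintype.sum_prod_type, Matrix.mulVec, dotProduct, Matrix.of_apply, Finset.mul_sum]
  exact Finset.sum_congr rfl fun a _ => Finset.sum_congr rfl fun b _ => by ring

/-- The entries of the rows of `W` projected on the orthogonal complement of `v`. -/
noncomputable def projectedRows (v : Fin w → ℝ) (θ : Fin k → Fin w → ℝ) (q : Fin k × Fin w) : ℝ :=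
  θ q.1 q.2 - (Matrix.of θ *ᵥ v) q.1 * v q.2 / (v ⬝ᵥ v)

/-- Components of a Gaussian row along `v` and orthogonal to `v` are uncorrelated. This allows `g =
W v` to be frozen while the projected rows stay random. -/
theorem indepFun_mulVec_projectedRows (σ : ℝ) {v : Fin w → ℝ} (hv : 0 < v ⬝ᵥ v) :
    IndepFun (fun θ : Fin k → Fin w → ℝ => Matrix.of θ *ᵥ v) (projectedRows v)
      (gaussianLaw k w σ) := by
  have h := (isIsotropicGaussian_gaussianLaw k w σ).indepFun_linear
    (fun (i : Fin k) (q : Fin k × Fin w) => if q.1 = i then v q.2 else 0)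
    (fun (p : Fin k × Fin w) (q : Fin k × Fin w) =>
      if q.1 = p.1 then (if q.2 = p.2 then 1 else 0) - v q.2 * v p.2 / (v ⬝ᵥ v) else 0)
    fun i p => by
      simp only [Fintype.sum_prod_type]
      rw [Finset.sum_eq_single i _ (by simp)]
      · by_cases hi : i = p.1
        · simp only [if_pos hi, if_true, mul_sub, Finset.sum_sub_distrib]
          have : ∑ x, v x * (v x * v p.2 / (v ⬝ᵥ v)) = (v ⬝ᵥ v) * (v p.2 / (v ⬝ᵥ v)) := by
            rw [dotProduct, Finset.sum_mul]
            exact Finset.sum_congr rfl fun a _ => by ring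
          rw [this]
          field_simp
          simp
        · simp [hi]
      · intro b _ hb
        simp [hb]
  convert h using 1
  · ext θ i
    simp only [Fintype.sum_prod_type, Matrix.mulVec, dotProduct, Matrix.of_apply]
    rw [Finset.sum_eq_single i] <;> simp +contextual [mul_comm]
  · ext θ p
    simp only [Fintype.sum_prod_type, projectedRows]
    rw [Finset.sum_eq_single p.1 _ (by simp)]
    · simp only [if_true, sub_mul, Finset.sum_sub_distrib, Matrix.mulVec, dotProduct,
        Matrix.of_apply, Finset.sum_mul, Finset.sum_div]
      congr 1
      · simp
      · exact Finset.sum_congr rfl fun a _ => by ring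
    · intro b _ hb
      simp [hb]

/-- Pythagoras: the projected rows combined with weights `g` give the component of `Wᵀ g` orthogonal
to `v`, whose component along `v` has squared length `(g ⬝ᵥ W v)² / |v|²`. -/
theorem sum_sq_projectedRows {v : Fin w → ℝ} (hv : 0 < v ⬝ᵥ v) (θ : Fin k → Fin w → ℝ)
    (g : Fin k → ℝ) :
    ∑ j, (∑ i, g i * projectedRows v θ (i, j)) ^ 2
      = ∑ j, ((Matrix.of θ)ᵀ *ᵥ g) j ^ 2 - (g ⬝ᵥ Matrix.of θ *ᵥ v) ^ 2 / (v ⬝ᵥ v) := by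
  set r := g ⬝ᵥ Matrix.of θ *ᵥ v with hr
  have e : ∀ j, ∑ i, g i * projectedRows v θ (i, j)
      = ((Matrix.of θ)ᵀ *ᵥ g) j - r / (v ⬝ᵥ v) * v j := by
    intro j
    simp only [projectedRows, mul_sub, Finset.sum_sub_distrib]
    congr 1
    · simp only [Matrix.mulVec, dotProduct, Matrix.of_apply, Matrix.transpose_apply]
      exact Finset.sum_congr rfl fun a _ => by ring
    · rw [hr, show g ⬝ᵥ Matrix.of θ *ᵥ v = ∑ i, g i * (Matrix.of θ *ᵥ v) i from rfl,
        Finset.sum_div, Finset.sum_mul]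
      exact Finset.sum_congr rfl fun a _ => by ring
  have hr' : ∑ j, ((Matrix.of θ)ᵀ *ᵥ g) j * v j = r := by
    rw [hr, Matrix.dotProduct_mulVec, ← Matrix.mulVec_transpose, dotProduct]
  have hvv : ∑ j, v j ^ 2 = v ⬝ᵥ v := by simp [dotProduct, pow_two]
  simp_rw [e, sub_sq, Finset.sum_add_distrib, Finset.sum_sub_distrib, mul_pow, ← Finset.mul_sum,
    hvv]
  have : ∑ j, 2 * ((Matrix.of θ)ᵀ *ᵥ g) j * (r / (v ⬝ᵥ v) * v j) = 2 * (r / (v ⬝ᵥ v)) * r := by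
    rw [← hr', Finset.mul_sum]
    exact Finset.sum_congr rfl fun a _ => by rw [hr']; ring
  rw [this]
  field_simp
  ring

end GramCorrelation

/-! ### A large positive eigenvalue of the initial imbalance. -/

section LargeEigenvalue

variable {k w : ℕ}

/-- For fixed `g`, `|Wᵀ g|²` is chi-square with `w` degrees of freedom, and the removed component
along `v` has a single degree of freedom; each costs at most `η σ² w |g|²`. -/
theorem measureReal_projectedRows_le {σ η : ℝ} (hσ : 0 < σ) (hη : 0 < η) (hη1 : η ≤ 1)
    {v : Fin w → ℝ} (hv : 0 < v ⬝ᵥ v) (g : Fin k → ℝ) :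
    (gaussianLaw k w σ).real {θ | ∑ j, (∑ i, g i * projectedRows v θ (i, j)) ^ 2
        < (1 - 2 * η) * (σ ^ 2 * w) * (g ⬝ᵥ g)} ≤ 4 * Real.exp (1 - η ^ 2 / 8 * w) := by
  by_cases hg : g = 0
  · subst hg
    simp
    positivity
  have hgg := dotProduct_self_pos_of_ne_zero hg
  have h1 := (isIsotropicGaussian_transpose_mulVec (w := w) σ g).measureReal_le (by positivity)
    (l := η / 4) (by positivity) (by linarith) (η * w)
  -- The threshold is `η w - 1` because the mean with one degree of freedom is `1`, so the square
  -- itself is compared with `η w`.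
  have h2 := (isIsotropicGaussian_bilinear σ g v).measureReal_le (by positivity)
    (l := η / 4) (by positivity) (by linarith) (η * w - 1)
  rw [Fintype.card_fin] at h1
  rw [Fintype.card_unit] at h2
  have e1 : 2 * Real.exp (2 * w * (η / 4) ^ 2 - η / 4 * (η * w))
      ≤ 2 * Real.exp (1 - η ^ 2 / 8 * w) := by
    refine mul_le_mul_of_nonneg_left (Real.exp_le_exp.2 ?_) zero_le_two
    nlinarith
  have e2 : 2 * Real.exp (2 * (1 : ℕ) * (η / 4) ^ 2 - η / 4 * (η * w - 1))
      ≤ 2 * Real.exp (1 - η ^ 2 / 8 * w) := by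
    have : 0 ≤ η ^ 2 * w := by positivity
    refine mul_le_mul_of_nonneg_left (Real.exp_le_exp.2 ?_) zero_le_two
    push_cast
    nlinarith
  refine (measureReal_mono (s₂ := {θ | η * w * (σ ^ 2 * (g ⬝ᵥ g)) ≤
      |∑ j, ((Matrix.of θ)ᵀ *ᵥ g) j ^ 2 - w * (σ ^ 2 * (g ⬝ᵥ g))|} ∪
    {θ | (η * w - 1) * (σ ^ 2 * ((g ⬝ᵥ g) * (v ⬝ᵥ v))) ≤
      |∑ _ : Unit, (g ⬝ᵥ Matrix.of θ *ᵥ v) ^ 2 - (1 : ℕ) * (σ ^ 2 * ((g ⬝ᵥ g) * (v ⬝ᵥ v)))|})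
    ?_ (measure_ne_top _ _)).trans ((measureReal_union_le _ _).trans ?_)
  · intro θ hθ
    by_contra hcon
    rw [Set.mem_union, not_or] at hcon
    have hc1 := (abs_lt.1 (not_le.1 fun h => hcon.1 (Set.mem_ofPred.2 h))).1
    have hc2 := (abs_lt.1 (not_le.1 fun h => hcon.2 (Set.mem_ofPred.2 h))).2
    have hθ' := Set.mem_ofPred.1 hθ
    rw [sum_sq_projectedRows hv] at hθ'
    simp only [Finset.univ_unique, Finset.sum_const, Finset.card_singleton, one_smul,
      Nat.cast_one, one_mul] at hc2
    have hc3 : (g ⬝ᵥ Matrix.of θ *ᵥ v) ^ 2 / (v ⬝ᵥ v) ≤ η * w * (σ ^ 2 * (g ⬝ᵥ g)) := by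
      rw [div_le_iff₀ hv]; nlinarith
    nlinarith
  · linarith

/-- For a fixed vector `v` and a Gaussian matrix `W`, the vector `v` is far from being an
eigenvector of `Wᵀ W`. -/
theorem measureReal_gram_correlation_le {σ η : ℝ} (hσ : 0 < σ) (hη : 0 < η) (hη1 : η ≤ 1)
    (hkw : k ≤ w) {v : Fin w → ℝ} (hv : 0 < v ⬝ᵥ v) :
    (gaussianLaw k w σ).real {θ |
        ¬ ((Matrix.of θ *ᵥ v) ⬝ᵥ (Matrix.of θ *ᵥ v) ≤ (1 + η) * (σ ^ 2 * w) * (v ⬝ᵥ v) ∧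
          (1 - 2 * η) * (σ ^ 2 * w) * ((Matrix.of θ *ᵥ v) ⬝ᵥ (Matrix.of θ *ᵥ v))
            + ((Matrix.of θ *ᵥ v) ⬝ᵥ (Matrix.of θ *ᵥ v)) ^ 2 / (v ⬝ᵥ v)
            ≤ ((Matrix.of θ)ᵀ *ᵥ (Matrix.of θ *ᵥ v)) ⬝ᵥ ((Matrix.of θ)ᵀ *ᵥ (Matrix.of θ *ᵥ v)))}
      ≤ 6 * Real.exp (1 - η ^ 2 / 8 * w) := by
  have hkw' : (k : ℝ) ≤ w := by exact_mod_cast hkw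
  have h1 := (isIsotropicGaussian_mulVec (k := k) σ v).measureReal_le (by positivity)
    (l := η / 4) (by positivity) (by linarith) (η * w)
  rw [Fintype.card_fin] at h1
  have e1 : 2 * Real.exp (2 * k * (η / 4) ^ 2 - η / 4 * (η * w))
      ≤ 2 * Real.exp (1 - η ^ 2 / 8 * w) := by
    have : (k : ℝ) * η ^ 2 ≤ w * η ^ 2 := by gcongr
    refine mul_le_mul_of_nonneg_left (Real.exp_le_exp.2 ?_) zero_le_two
    nlinarith
  let F : Set ((Fin k → ℝ) × (Fin k × Fin w → ℝ)) := {q | ∑ j, (∑ i, q.1 i * q.2 (i, j)) ^ 2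
    < (1 - 2 * η) * (σ ^ 2 * w) * (q.1 ⬝ᵥ q.1)}
  have hF : MeasurableSet F := by
    refine measurableSet_lt ?_ ?_
    · fun_prop
    · simp only [dotProduct]; fun_prop
  have hmg : Measurable fun θ : Fin k → Fin w → ℝ => Matrix.of θ *ᵥ v :=
    measurable_pi_iff.2 (isIsotropicGaussian_mulVec σ v).measurable
  have hmp : Measurable (projectedRows v : (Fin k → Fin w → ℝ) → _) := by
    refine measurable_pi_iff.2 fun q => ?_
    have := (isIsotropicGaussian_mulVec (k := k) σ v).measurable q.1
    exact (measurable_entry k w q).sub ((this.mul_const _).div_const _)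
  have h2 : (gaussianLaw k w σ).real
      ((fun θ => (Matrix.of θ *ᵥ v, projectedRows v θ)) ⁻¹' F)
        ≤ 4 * Real.exp (1 - η ^ 2 / 8 * w) := by
    -- By independence the joint law is a product, so the estimate for each fixed `g` applies to the
    -- random `g = W v`. Pythagoras then makes `g ⬝ᵥ W v = |g|²` and yields the quartic term.
    have hind := (indepFun_iff_map_prod_eq_prod_map_map hmg.aemeasurable hmp.aemeasurable).1
      (indepFun_mulVec_projectedRows (k := k) σ hv)
    rw [← map_measureReal_apply (hmg.prodMk hmp) hF, hind]
    have := Measure.isProbabilityMeasure_map (μ := gaussianLaw k w σ) hmg.aemeasurable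
    have := Measure.isProbabilityMeasure_map (μ := gaussianLaw k w σ) hmp.aemeasurable
    refine measure_prod_le_of_forall_section_le hF fun g => ?_
    rw [map_measureReal_apply hmp (hF.preimage measurable_prodMk_left)]
    exact measureReal_projectedRows_le hσ hη hη1 hv g
  refine (measureReal_mono (s₂ := {θ | η * w * (σ ^ 2 * (v ⬝ᵥ v)) ≤
      |∑ i, (Matrix.of θ *ᵥ v) i ^ 2 - k * (σ ^ 2 * (v ⬝ᵥ v))|} ∪
    ((fun θ => (Matrix.of θ *ᵥ v, projectedRows v θ)) ⁻¹' F)) ?_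
      (measure_ne_top _ _)).trans
      ((measureReal_union_le _ _).trans (by linarith))
  intro θ hθ
  by_contra hcon
  rw [Set.mem_union, not_or] at hcon
  refine hθ ?_
  have hc1 := (abs_lt.1 (not_le.1 fun h => hcon.1 (Set.mem_ofPred.2 h))).2
  have hc2 : (1 - 2 * η) * (σ ^ 2 * w) * ((Matrix.of θ *ᵥ v) ⬝ᵥ (Matrix.of θ *ᵥ v))
      ≤ ∑ j, (∑ i, (Matrix.of θ *ᵥ v) i * projectedRows v θ (i, j)) ^ 2 :=
    not_lt.1 fun h => hcon.2 h
  rw [sum_sq_projectedRows hv] at hc2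
  have hs : ∀ {p : ℕ} (x : Fin p → ℝ), ∑ i, x i ^ 2 = x ⬝ᵥ x := fun x => by
    simp [dotProduct, pow_two]
  rw [hs] at hc1 hc2
  refine ⟨?_, by linarith⟩
  have : (k : ℝ) * (σ ^ 2 * (v ⬝ᵥ v)) ≤ w * (σ ^ 2 * (v ⬝ᵥ v)) := by gcongr
  linarith

/-- If `v` is not nearly an eigenvector of `Wᵀ W`, then `v vᵀ - Wᵀ W` has a large positive
eigenvalue; a test vector is a perturbation of `v` in the direction `Wᵀ W v`. -/
theorem exists_large_quadForm {W : Matrix (Fin k) (Fin w) ℝ} {v : Fin w → ℝ} {s α η : ℝ}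
    (hs : 0 < s) (hα : α = 1 / 16000) (hη : η = α / 8) (hW : ‖W‖ ^ 2 ≤ 43 * s)
    (hv : (1 - η) * s ≤ v ⬝ᵥ v)
    (h1 : (W *ᵥ v) ⬝ᵥ (W *ᵥ v) ≤ (1 + η) * s * (v ⬝ᵥ v))
    (h2 : (1 - 2 * η) * s * ((W *ᵥ v) ⬝ᵥ (W *ᵥ v)) + ((W *ᵥ v) ⬝ᵥ (W *ᵥ v)) ^ 2 / (v ⬝ᵥ v)
      ≤ (Wᵀ *ᵥ (W *ᵥ v)) ⬝ᵥ (Wᵀ *ᵥ (W *ᵥ v))) :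
    ∃ u : Fin w → ℝ, u ≠ 0 ∧
      α / 4 * s * (u ⬝ᵥ u) ≤ (v ⬝ᵥ u) ^ 2 - (W *ᵥ u) ⬝ᵥ (W *ᵥ u) := by
  have hη0 : 0 < η := by rw [hη, hα]; norm_num
  have hη1 : η ≤ 1 / 100000 := by rw [hη, hα]; norm_num
  have hα0 : 0 < α := by rw [hα]; norm_num
  set V := v ⬝ᵥ v with hV
  have hV0 : 0 < V := lt_of_lt_of_le (mul_pos (by linarith) hs) hv
  set g := W *ᵥ v with hg
  set f := Wᵀ *ᵥ g with hf
  -- `x` is the Rayleigh quotient of `WᵀW` at `v` in units of `s`. For `x` well below `1` the vector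
  -- `v` itself would do; the perturbation is needed for `x` near `1`.
  obtain ⟨x, hx⟩ : ∃ x, x = (g ⬝ᵥ g) / (s * V) := ⟨_, rfl⟩
  have hG : g ⬝ᵥ g = x * s * V := by rw [hx]; field_simp
  have hx0 : 0 ≤ x := by rw [hx]; have := dotProduct_self_nonneg' g; positivity
  have hx1 : x ≤ 1 + η := by
    rw [hG] at h1
    have : x * (s * V) ≤ (1 + η) * (s * V) := by linarith
    exact le_of_mul_le_mul_right this (by positivity)
  have hvf : v ⬝ᵥ f = x * s * V := by
    rw [hf, Matrix.dotProduct_mulVec, Matrix.vecMul_transpose, ← hg, hG]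
  have hgWf : g ⬝ᵥ W *ᵥ f = f ⬝ᵥ f := by
    rw [Matrix.dotProduct_mulVec, ← Matrix.mulVec_transpose, ← hf]
  have hH1 : (x ^ 2 + (1 - 2 * η) * x) * (s ^ 2 * V) ≤ f ⬝ᵥ f := by
    refine le_trans (le_of_eq ?_) h2
    rw [hG]
    field_simp
    ring
  have hH2 : f ⬝ᵥ f ≤ 43 * s * (x * s * V) := by
    have := Matrix.dotProduct_mulVec_self_le Wᵀ g
    rw [Matrix.norm_transpose_eq, ← hf, hG] at this
    exact this.trans (by gcongr)
  have hff := dotProduct_self_nonneg' f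
  have hWf : (W *ᵥ f) ⬝ᵥ (W *ᵥ f) ≤ 43 * s * (43 * s * (x * s * V)) :=
    (Matrix.dotProduct_mulVec_self_le W f).trans (by gcongr)
  set b := α / s with hb
  have hbs : b * s = α := by rw [hb]; field_simp
  have hb0 : 0 < b := by positivity
  have hvu : v ⬝ᵥ (v - b • f) = V * (1 - α * x) := by
    rw [dotProduct_sub, dotProduct_smul, smul_eq_mul, hvf, ← hbs]; ring
  have hWu : (W *ᵥ (v - b • f)) ⬝ᵥ (W *ᵥ (v - b • f))
      ≤ s * V * (x - 2 * α * (x ^ 2 + (1 - 2 * η) * x) + α ^ 2 * 1849 * x) := by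
    have e : (W *ᵥ (v - b • f)) ⬝ᵥ (W *ᵥ (v - b • f))
        = x * s * V - 2 * b * (f ⬝ᵥ f) + b ^ 2 * ((W *ᵥ f) ⬝ᵥ (W *ᵥ f)) := by
      rw [Matrix.mulVec_sub, Matrix.mulVec_smul, ← hg, sub_dotProduct, dotProduct_sub,
        dotProduct_sub, smul_dotProduct, smul_dotProduct, dotProduct_smul, dotProduct_smul,
        dotProduct_comm (W *ᵥ f) g, hgWf, hG]
      simp only [smul_eq_mul]
      ring
    rw [e]
    calc _ ≤ x * s * V - 2 * b * ((x ^ 2 + (1 - 2 * η) * x) * (s ^ 2 * V))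
          + b ^ 2 * (43 * s * (43 * s * (x * s * V))) := by gcongr
      _ = _ := by rw [← hbs]; ring
  have huu : (v - b • f) ⬝ᵥ (v - b • f) ≤ 4 * V := by
    have e : (v - b • f) ⬝ᵥ (v - b • f) = V - 2 * α * x * V + b ^ 2 * (f ⬝ᵥ f) := by
      rw [sub_dotProduct, dotProduct_sub, dotProduct_sub, smul_dotProduct, smul_dotProduct,
        dotProduct_smul, dotProduct_smul, dotProduct_comm f v, hvf, ← hV, ← hbs]
      simp only [smul_eq_mul]
      ring
    have h3 : b ^ 2 * (f ⬝ᵥ f) ≤ 43 * α ^ 2 * x * V := by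
      calc _ ≤ b ^ 2 * (43 * s * (x * s * V)) := by gcongr
        _ = _ := by rw [← hbs]; ring
    have h4 : 43 * α ^ 2 * x * V ≤ 3 * V := by
      have : 43 * α ^ 2 * x ≤ 3 := by rw [hα]; linarith
      gcongr
    have h5 : 0 ≤ 2 * α * x * V := by positivity
    linarith
  refine ⟨v - b • f, fun h0 => ?_, ?_⟩
  · rw [h0, dotProduct_zero] at hvu
    have : 0 < 1 - α * x := by rw [hα]; linarith
    have := mul_pos hV0 this
    linarith
  · rw [hvu]
    have hsq : (1 - η) * s * V * (1 - α * x) ^ 2 ≤ (V * (1 - α * x)) ^ 2 := by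
      calc _ ≤ V * V * (1 - α * x) ^ 2 := by gcongr
        _ = _ := by ring
    -- To first order in `α`, the loss `2αx` in `(v ⬝ᵥ u)²` cancels the gain `2αx` in `|W u|²`,
    -- leaving `1 - x + 2αx²`. This is about `2α` at `x = 1`, and `1849 α² x` (`1849 = 43²`)
    -- together with the `η` terms consumes less than `α`. Bounding `x²` below by its tangent makes
    -- the inequality affine in `x`, up to the bounds on the range of `x`.
    have hmain : α ≤ (1 - η) * (1 - α * x) ^ 2
        - (x - 2 * α * (x ^ 2 + (1 - 2 * η) * x) + α ^ 2 * 1849 * x) := by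
      have hx2 : 2 * x - 1 ≤ x ^ 2 := by nlinarith [sq_nonneg (x - 1)]
      have h3 : 1 - 2 * α * x ≤ (1 - α * x) ^ 2 := by nlinarith [sq_nonneg (α * x)]
      have h4 : (1 - η) * (1 - 2 * α * x) ≤ (1 - η) * (1 - α * x) ^ 2 := by
        have : 0 ≤ 1 - η := by linarith
        gcongr
      subst hη
      subst hα
      nlinarith
    have h6 : α * (s * V) ≤ ((1 - η) * (1 - α * x) ^ 2
        - (x - 2 * α * (x ^ 2 + (1 - 2 * η) * x) + α ^ 2 * 1849 * x)) * (s * V) := by gcongr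
    have h7 : α / 4 * s * ((v - b • f) ⬝ᵥ (v - b • f)) ≤ α / 4 * s * (4 * V) := by gcongr
    generalize (v - b • f) ⬝ᵥ (v - b • f) = q₁ at *
    generalize (W *ᵥ (v - b • f)) ⬝ᵥ (W *ᵥ (v - b • f)) = q₂ at *
    clear_value V
    linarith

end LargeEigenvalue

/-! ### Good initializations and the final probability estimate. -/

section MainTheorem

variable {din dout w : ℕ}

/-- The first column of `W₁` has nearly its expected length with high probability. -/
theorem measureReal_column_le {σ η : ℝ} (hσ : 0 < σ) (hη : 0 < η) (hη1 : η ≤ 1) (j : Fin din) :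
    (initLaw din w dout σ).real {θ | ¬ (1 - η) * (σ ^ 2 * w) ≤
      (fun i => θ.1 i j) ⬝ᵥ (fun i => θ.1 i j)} ≤ 2 * Real.exp (1 - η ^ 2 / 8 * w) := by
  have h := isIsotropicGaussian_stackedWeights_mulVec (w := w) (dout := dout) σ
    (Pi.single (Sum.inl j) 1)
  have e : ∀ θ : (Fin w → Fin din → ℝ) × (Fin dout → Fin w → ℝ),
      stackedWeights (Matrix.of θ.1) (Matrix.of θ.2) *ᵥ Pi.single (Sum.inl j) 1
        = fun i => θ.1 i j := by
    intro θ
    ext i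
    simp [stackedWeights]
  simp only [e, single_dotProduct, Pi.single_eq_same, mul_one] at h
  have h1 := h.measureReal_le (by positivity) (l := η / 4) (by positivity) (by linarith) (η * w)
  rw [Fintype.card_fin] at h1
  refine (measureReal_mono ?_ (measure_ne_top _ _)).trans (h1.trans ?_)
  · intro θ hθ
    have hθ' := not_le.1 hθ
    refine Set.mem_ofPred.2 (le_abs.2 (Or.inr ?_))
    simp only [dotProduct, ← pow_two] at hθ'
    linarith
  · refine mul_le_mul_of_nonneg_left (Real.exp_le_exp.2 ?_) zero_le_two
    nlinarith

/-- The relation between the first column of `W₁` and `W₂` used to exhibit a large positive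
eigenvalue of the imbalance. -/
def GramCorrelation (η s : ℝ) (v : Fin w → ℝ) (θ : Fin dout → Fin w → ℝ) : Prop :=
  (Matrix.of θ *ᵥ v) ⬝ᵥ (Matrix.of θ *ᵥ v) ≤ (1 + η) * s * (v ⬝ᵥ v) ∧
    (1 - 2 * η) * s * ((Matrix.of θ *ᵥ v) ⬝ᵥ (Matrix.of θ *ᵥ v))
      + ((Matrix.of θ *ᵥ v) ⬝ᵥ (Matrix.of θ *ᵥ v)) ^ 2 / (v ⬝ᵥ v)
      ≤ ((Matrix.of θ)ᵀ *ᵥ (Matrix.of θ *ᵥ v)) ⬝ᵥ ((Matrix.of θ)ᵀ *ᵥ (Matrix.of θ *ᵥ v))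

theorem measurableSet_gramCorrelation (η s : ℝ) (j : Fin din) :
    MeasurableSet {θ : (Fin w → Fin din → ℝ) × (Fin dout → Fin w → ℝ) |
      GramCorrelation η s (fun i => θ.1 i j) θ.2} := by
  have h1 : ∀ a b, Measurable fun θ : (Fin w → Fin din → ℝ) × (Fin dout → Fin w → ℝ) => θ.1 a b :=
    fun a b => by fun_prop
  have h2 : ∀ a b, Measurable fun θ : (Fin w → Fin din → ℝ) × (Fin dout → Fin w → ℝ) => θ.2 a b :=
    fun a b => by fun_prop
  simp only [GramCorrelation, Matrix.mulVec, dotProduct, Matrix.of_apply, Matrix.transpose_apply]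
  rw [Set.ofPred_and]
  exact (measurableSet_le (by fun_prop) (by fun_prop)).inter
    (measurableSet_le (by fun_prop) (by fun_prop))

theorem measureReal_not_gramCorrelation_le {σ η : ℝ} (hσ : 0 < σ) (hη : 0 < η) (hη1 : η ≤ 1)
    (hw : dout ≤ w) (j : Fin din) :
    (initLaw din w dout σ).real {θ | 0 < (fun i => θ.1 i j) ⬝ᵥ (fun i => θ.1 i j) ∧
      ¬ GramCorrelation η (σ ^ 2 * w) (fun i => θ.1 i j) θ.2}
        ≤ 6 * Real.exp (1 - η ^ 2 / 8 * w) := by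
  have hpos : MeasurableSet {θ : (Fin w → Fin din → ℝ) × (Fin dout → Fin w → ℝ) |
      0 < (fun i => θ.1 i j) ⬝ᵥ (fun i => θ.1 i j)} := by
    simp only [dotProduct]
    exact measurableSet_lt measurable_const (by fun_prop)
  -- The event includes `0 < |v|²` so that every section is controlled, the one at `v = 0` being
  -- empty.
  refine measure_prod_le_of_forall_section_le
    (hpos.inter (measurableSet_gramCorrelation η (σ ^ 2 * w) j).compl) fun a => ?_
  by_cases ha : 0 < (fun i => a i j) ⬝ᵥ (fun i => a i j)
  · refine (measureReal_mono ?_ (measure_ne_top _ _)).trans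
      (measureReal_gram_correlation_le (k := dout) hσ hη hη1 hw ha)
    exact fun θ hθ => hθ.2
  · refine (measureReal_mono (s₂ := ∅) ?_ (measure_ne_top _ _)).trans ?_
    · exact fun θ hθ => ha hθ.1
    · rw [measureReal_empty]; positivity

/-- Deterministic form of the result: it holds for all gradient flows started at parameters which
satisfy the three high probability properties. -/
theorem mixed_dynamics_of_good_initialization {σ η : ℝ} (hσ : 0 < σ) (hη : η = 1 / 128000)
    (hd : 0 < max din dout) (hw : max din dout ≤ w) (j : Fin din)
    {C : Matrix (Fin dout) (Fin din) ℝ → ℝ} (hC : Differentiable ℝ C)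
    {θ : (Fin w → Fin din → ℝ) × (Fin dout → Fin w → ℝ)}
    (h1 : ‖(stackedWeights (Matrix.of θ.1) (Matrix.of θ.2))ᵀ *
      stackedWeights (Matrix.of θ.1) (Matrix.of θ.2) - (σ ^ 2 * w) • 1‖
        ≤ 42 * √((max din dout : ℕ) / (w : ℝ)) * (σ ^ 2 * w))
    (h2 : (1 - η) * (σ ^ 2 * w) ≤ (fun i => θ.1 i j) ⬝ᵥ (fun i => θ.1 i j))
    (h3 : GramCorrelation η (σ ^ 2 * w) (fun i => θ.1 i j) θ.2)
    {T : ℝ} {W₁ : ℝ → Matrix (Fin w) (Fin din) ℝ} {W₂ : ℝ → Matrix (Fin dout) (Fin w) ℝ}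
    (hflow : IsGradientFlow C T W₁ W₂) (h₁ : W₁ 0 = Matrix.of θ.1) (h₂ : W₂ 0 = Matrix.of θ.2)
    {t : ℝ} (ht : t ∈ Set.Icc 0 T) :
    let K : ℝ := (1 + 42) + 2 * (1 + 42) * 42 / (1 / 64000) + 6 * 42 * (2 + (1 + 42) / (1 / 64000))
    ‖(W₁ t)ᵀ * W₁ t - mixedC₁ w σ (W₂ t * W₁ t)‖ ≤ mixedError K w dout σ (W₁ t) ∧
      ‖W₂ t * (W₂ t)ᵀ - mixedC₂ w σ (W₂ t * W₁ t)‖ ≤ mixedError K w dout σ (W₁ t) := by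
  intro K
  have hw0 : 0 < w := hd.trans_le hw
  have hw0' : (0 : ℝ) < w := by exact_mod_cast hw0
  have hs : 0 < σ ^ 2 * (w : ℝ) := by positivity
  have hε1 : √((max din dout : ℕ) / (w : ℝ)) ≤ 1 :=
    Real.sqrt_le_one.2 (div_le_one_of_le₀ (by exact_mod_cast hw) hw0'.le)
  set U₁ : Matrix (Fin w) (Fin din) ℝ := Matrix.of θ.1
  set U₂ : Matrix (Fin dout) (Fin w) ℝ := Matrix.of θ.2
  set v : Fin w → ℝ := fun i => θ.1 i j with hv
  have hU₂ : ‖U₂‖ ^ 2 ≤ 43 * (σ ^ 2 * w) := by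
    have hZ := norm_sq_le_of_norm_gram_sub_le hs.le h1
    have hle : ‖U₂ᵀ‖ ≤ ‖stackedWeights U₁ U₂‖ := by
      refine Matrix.norm_le_of_dotProduct_mulVec_self_le (norm_nonneg _) fun x => ?_
      have := Matrix.dotProduct_mulVec_self_le (stackedWeights U₁ U₂) (Sum.elim 0 x)
      simpa [stackedWeights, Matrix.fromCols_mulVec] using this
    rw [Matrix.norm_transpose_eq] at hle
    calc ‖U₂‖ ^ 2 ≤ ‖stackedWeights U₁ U₂‖ ^ 2 := by gcongr
      _ ≤ σ ^ 2 * w + 42 * √((max din dout : ℕ) / (w : ℝ)) * (σ ^ 2 * w) := hZ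
      _ ≤ σ ^ 2 * w + 42 * 1 * (σ ^ 2 * w) := by gcongr
      _ = _ := by ring
  -- With `α = 1/16000` this gives the eigenvalue constant `α / 4 = 1/64000`, and `η = α / 8 =
  -- 1/128000`.
  obtain ⟨u, hu0, hu⟩ := exists_large_quadForm (W := U₂) (v := v) (α := 1 / 16000) (η := η) hs rfl
    (by rw [hη]; norm_num) hU₂ h2 h3.1 h3.2
  have hD := hflow.imbalance_eq hC ht
  rw [h₁, h₂] at hD
  have hmain := norm_gram_sub_mixed_le hσ hw0 (Real.sqrt_nonneg _) hε1 (by norm_num : (0 : ℝ) < 42)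
    (by norm_num : (0 : ℝ) < 1 / 64000) hD h1 ⟨u, hu0, ?_⟩
  · exact hmain
  · rw [Matrix.sub_mulVec, dotProduct_sub, Matrix.dotProduct_transpose_mul_self_mulVec]
    have e1 : u ⬝ᵥ (U₁ * U₁ᵀ) *ᵥ u = (U₁ᵀ *ᵥ u) ⬝ᵥ (U₁ᵀ *ᵥ u) := by
      rw [← Matrix.dotProduct_transpose_mul_self_mulVec, Matrix.transpose_transpose]
    -- One column suffices: `W₁W₁ᵀ ≥ v vᵀ`, the other columns adding nonnegative terms.
    have e2 : (v ⬝ᵥ u) ^ 2 ≤ (U₁ᵀ *ᵥ u) ⬝ᵥ (U₁ᵀ *ᵥ u) := by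
      have e3 : (U₁ᵀ *ᵥ u) j = v ⬝ᵥ u := rfl
      rw [← e3, pow_two]
      exact Finset.single_le_sum (f := fun i => (U₁ᵀ *ᵥ u) i * (U₁ᵀ *ᵥ u) i)
        (fun i _ => mul_self_nonneg _) (Finset.mem_univ j)
    rw [e1]
    linarith

theorem exists_nat_exp_tail_le {δ τ : ℝ} (hδ : 0 < δ) (hτ : 0 < τ) (hτ1 : τ ≤ 1) :
    ∃ d₀ : ℕ, ∀ d w : ℕ, d₀ ≤ d → d ≤ w →
      2 * Real.exp (-(d : ℝ)) + (2 * Real.exp (1 - τ * w) + 6 * Real.exp (1 - τ * w)) ≤ δ := by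
  obtain ⟨d₀, hd₀⟩ := exists_nat_ge (26 / (δ * τ))
  refine ⟨d₀, fun d w hd hw => ?_⟩
  have hd' : (d₀ : ℝ) ≤ d := by exact_mod_cast hd
  have hw' : (d : ℝ) ≤ w := by exact_mod_cast hw
  have hdn : (0 : ℝ) ≤ d := Nat.cast_nonneg d
  have h1 : Real.exp (-(d : ℝ)) ≤ Real.exp (-(τ * d)) := by
    apply Real.exp_le_exp.2; nlinarith
  have h2 : Real.exp (1 - τ * w) ≤ 3 * Real.exp (-(τ * d)) := by
    calc Real.exp (1 - τ * w) ≤ Real.exp (1 + -(τ * d)) := by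
          apply Real.exp_le_exp.2; nlinarith
      _ = Real.exp 1 * Real.exp (-(τ * d)) := Real.exp_add _ _
      _ ≤ _ := by gcongr; exact Real.exp_one_lt_three.le
  -- `26 = 2 + (2 + 6) · 3`, where `3` bounds the factor `exp 1`; the decay `exp (-y) ≤ 1 / (1 + y)`
  -- is enough.
  have h3 : 26 * Real.exp (-(τ * d)) ≤ δ := by
    rw [Real.exp_neg, ← div_eq_mul_inv, div_le_iff₀ (Real.exp_pos _)]
    have h4 := Real.add_one_le_exp (τ * d)
    rw [div_le_iff₀ (by positivity)] at hd₀
    have h5 : d₀ * (δ * τ) ≤ d * (δ * τ) := by gcongr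
    nlinarith
  linarith

end MainTheorem

theorem theorem1 :
    ∃ K : ℝ, 0 < K ∧ ∀ δ : ℝ, 0 < δ → δ < 1 → ∃ d₀ : ℕ,
      ∀ din dout w : ℕ, 0 < din → 0 < dout → d₀ ≤ max din dout → max din dout ≤ w →
      ∀ σ : ℝ, 0 < σ →
      ∀ C : Matrix (Fin dout) (Fin din) ℝ → ℝ, Differentiable ℝ C →
        initLaw din w dout σ {θ | ¬ ∀ (T : ℝ) (W₁ : ℝ → Matrix (Fin w) (Fin din) ℝ)
            (W₂ : ℝ → Matrix (Fin dout) (Fin w) ℝ),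
            IsGradientFlow C T W₁ W₂ → W₁ 0 = Matrix.of θ.1 → W₂ 0 = Matrix.of θ.2 →
            ∀ t ∈ Set.Icc 0 T,
              ‖(W₁ t)ᵀ * W₁ t - mixedC₁ w σ (W₂ t * W₁ t)‖ ≤ mixedError K w dout σ (W₁ t) ∧
              ‖W₂ t * (W₂ t)ᵀ - mixedC₂ w σ (W₂ t * W₁ t)‖ ≤ mixedError K w dout σ (W₁ t) ∧
              ∃ E : Matrix (Fin dout) (Fin din) ℝ,
                HasDerivWithinAt (fun s => W₂ s * W₁ s)
                  (-(mixedC₂ w σ (W₂ t * W₁ t) * matrixGrad C (W₂ t * W₁ t))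
                    - matrixGrad C (W₂ t * W₁ t) * mixedC₁ w σ (W₂ t * W₁ t) + E)
                  (Set.Icc 0 T) t ∧
                ‖E‖ ≤ 2 * mixedError K w dout σ (W₁ t) * ‖matrixGrad C (W₂ t * W₁ t)‖}
          ≤ ENNReal.ofReal δ := by
  refine ⟨(1 + 42) + 2 * (1 + 42) * 42 / (1 / 64000) + 6 * 42 * (2 + (1 + 42) / (1 / 64000)),
    by norm_num, fun δ hδ _ => ?_⟩
  obtain ⟨η, hη⟩ : ∃ η : ℝ, η = 1 / 128000 := ⟨_, rfl⟩
  have hη0 : 0 < η := by rw [hη]; norm_num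
  have hη1 : η ≤ 1 := by rw [hη]; norm_num
  obtain ⟨d₀, hd₀⟩ := exists_nat_exp_tail_le hδ (τ := η ^ 2 / 8) (by positivity) (by nlinarith)
  refine ⟨d₀, fun din dout w hdin hdout hd hw σ hσ C hC => ?_⟩
  have hdpos : 0 < max din dout := hdin.trans_le (le_max_left _ _)
  let j : Fin din := ⟨0, hdin⟩
  have hw0 : (0 : ℝ) < w := by exact_mod_cast hdpos.trans_le hw
  rw [← ofReal_measureReal (measure_ne_top _ _)]
  refine ENNReal.ofReal_le_ofReal ?_
  have p1 := measureReal_norm_stackedWeights_gram_sub_le hσ hdpos hw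
  have p2 := measureReal_column_le (dout := dout) (w := w) hσ hη0 hη1 j
  have p3 := measureReal_not_gramCorrelation_le hσ hη0 hη1 ((le_max_right din dout).trans hw) j
  refine le_trans ?_ (hd₀ _ w hd hw)
  -- The bad set quantifies over all flows and need not be measurable; it is covered by three
  -- explicit events that depend only on the initial weights.
  refine le_trans (measureReal_mono ?_ (measure_ne_top _ _)) ((measureReal_union_le _ _).trans
    (add_le_add p1 ((measureReal_union_le _ _).trans (add_le_add p2 p3))))
  intro θ hθ
  by_contra hcon
  rw [Set.mem_union, Set.mem_union, not_or, not_or] at hcon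
  obtain ⟨c1, c2, c3⟩ := hcon
  refine hθ fun T W₁ W₂ hflow h₁ h₂ t ht => ?_
  have g1 := not_not.1 c1
  have g2 := not_not.1 c2
  have hpos : 0 < (fun i => θ.1 i j) ⬝ᵥ (fun i => θ.1 i j) :=
    lt_of_lt_of_le (mul_pos (by rw [hη]; norm_num) (by positivity)) g2
  have g3 : GramCorrelation η (σ ^ 2 * w) (fun i => θ.1 i j) θ.2 := by
    by_contra h
    exact c3 ⟨hpos, h⟩
  have hmain := mixed_dynamics_of_good_initialization hσ hη hdpos hw j hC g1 g2 g3 hflow h₁ h₂ ht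
  exact ⟨hmain.1, hmain.2, hflow.exists_mixed_dynamics hC ht hmain.1 hmain.2⟩
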